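/- **Theorem (Correctness of the HoTT interpretation).** Let $\mathcal L$ be an essentially finite $h$-signature; for instance, let $\mathcal L$ be (the underlying $h$-signature of) any essentially finite $\mathrm{FOL}_{\cong}$-signature. If $\mathcal S$ is a derivable judgment of the logical type theory $LTT_{\mathcal L}$, then its interpretation $[\![\mathcal S]\!]$ is a derivable judgment of HoTT. The notions are as follows. *Signatures.* Sort symbols are generated by non-logical symbols and by $\cong_K$ (isomorphism), $\rho_K$ (reflexivity), $\tau_f$ (transport), for $K$ a sort symbol and $f$ an arrow symbol; arrow symbols are generated by non-logical symbols and by $s_K,t_K$, $r_K$, $f_1,f_2,e_f$. A *FOLDS signature* is a category $\mathcal L$ whose objects (called sorts) and non-identity arrows are such symbols, which is skeletal and has no non-identity endomorphisms, and in which the set $K/\!/\mathcal L$ of non-identity arrows out of each sort $K$ is finite, together with a strict partial order on sorts such that $K_f<K$ for each non-identity $f\colon K\to K_f$ and a strict partial order on arrows such that $K_f<K_g$ implies $f<g$; the orders are total on the set $NL(\mathcal L)$ of non-logical sorts and on each $K/\!/\mathcal L$, and tuples indexed by these sets are listed in increasing order. An arrow is *top-level* if it is not an identity and not a composite of two non-identity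 arrows; $\mathrm{Top}(K)$ is the set of top-level arrows out of $K$. An *$h$-signature* is a FOLDS signature with a function $h\colon \mathrm{ob}\,\mathcal L\to\mathbb N\cup\{\infty\}$ such that (with $\infty-m=\infty$): 1. if $\cong_K\in\mathcal L$, then $K\in\mathcal L$, $h(K)\ge 2$, $\mathrm{Top}(\cong_K)=\{s_K,t_K\}=\mathcal L(\cong_K,K)$, $f s_K=f t_K$ for all $f\in K/\!/\mathcal L$, and $h(\cong_K)=h(K)-1$; 2. if $\rho_K\in\mathcal L$, then $K\in\mathcal L$, $h(K)\ge2$, $\mathrm{Top}(\rho_K)=\{r_K\}=\mathcal L(\rho_K,\cong_K)$, $s_Kr_K=t_Kr_K$, and $h(\rho_K)=h(K)-2$; 3. if $\tau_f\in\mathcal L$, then $f\colon A\to K$ is a top-level arrow of $\mathcal L$, $h(K)\ge2$, $\mathrm{Top}(\tau_f)=\{e_f,f_1,f_2\}$ with $e_f\colon\tau_f\to\,\cong_K$ and $f_1,f_2\colon\tau_f\to A$, $s_Ke_f=ff_1$, $t_Ke_f=ff_2$, $gf_1=gf_2$ for all $g\in A/\!/\mathcal L$ with $g\ne f$, $qff_1=qff_2$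 for all $q\in K/\!/\mathcal L$, and $h(\tau_f)=h(A)-1$; 4. $h(K)=0$ only if $K$ is a reflexivity or a transport sort. It is *essentially finite* if $NL(\mathcal L)$ is finite. A $\mathrm{FOL}_{\cong}$-signature is an $h$-signature that has all the logical sorts $\cong_K,\rho_K,\tau_f$ allowed by its $h$-levels. *The theory $LTT_{\mathcal L}$.* Sort expressions are $A(x_f)_{f\in A/\!/\mathcal L}$, for $A\in\mathcal L$ and variables $x_f$; contexts are lists of declarations $x\colon K$; formulas are generated by $\bot,\top,\wedge,\vee,\to,\forall x\colon K,\exists x\colon K$. The judgments are $\Gamma\ \mathbf{ok}$, $\Gamma\vdash K\ \mathbf{Sort}$, $\Gamma\vdash x\colon K$ and $\Gamma\vdash\phi\ \mathbf{formula}$. The rules are: $\varnothing\ \mathbf{ok}$; extension of a context by a fresh variable of a well-formed sort; weakening for sorts and formulas; $\Gamma,x\colon K,\Delta\vdash x\colon K$ if that context is well-formed; for each sort $K$ (logical or not) $K$-formation: $\Gamma\vdash K(x_f)_{f}\ \mathbf{Sort}$ if $\Gamma\ \mathbf{ok}$ and $\Gamma\vdash x_f\colon K_f(x_{pf})_{p\in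 K_f/\!/\mathcal L}$ for all $f\in K/\!/\mathcal L$; and the usual formation rules for the connectives and quantifiers. *HoTT* is intensional Martin-Löf type theory with judgments $\Gamma\ \mathbf{ok}$, $\Gamma\vdash A\ \mathbf{Type}$, $\Gamma\vdash A\equiv B\ \mathbf{Type}$, $\Gamma\vdash a\colon A$, $\Gamma\vdash a\equiv b\colon A$, with the types $\Pi,\Sigma,\mathtt{Id},\mathbf 1,\mathbf 0,+$, propositional truncation $\|{-}\|$, and a universe $\mathcal U$ à la Tarski (with decoding $\mathtt{El}$, closed under these type formers) satisfying the univalence axiom. $\mathcal U^{m}$ is the type of types in $\mathcal U$ of $h$-level $m$, with $\mathcal U^\infty=\mathcal U$; a term of $\mathcal U^m$ is conflated with its first projection. $\mathtt{trans}_p^{x.P}(t)\colon P[b/x]$ is the transport of $t\colon P[a/x]$ along $p\colon\mathtt{Id}(a,b)$. *The interpretation.* For an interpretation of the non-logical sorts $N$ by terms $N^{\mathcal M}$ and for terms $(a_f)_{f\in K/\!/\mathcal L}$, the type $[\![K(a_f)_f]\!]$ is defined by recursion on the sort $K$: $$ \begin{aligned} K(\mathbf a)&\mapsto \mathtt{El}\bigl(\mathtt{app}[K^{\mathcal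 M}(\mathbf a)]\bigr)\qquad (K\in NL(\mathcal L)),\\ \cong_K(\mathbf a)&\mapsto \mathtt{Id}_{[\![K(a_{ps_K})_p]\!]}(a_{s_K},a_{t_K}),\\ \rho_K(\mathbf a)&\mapsto \mathtt{Id}_{\mathtt{Id}_{[\![K(a_{ps_Kr_K})_p]\!]}(a_{s_Kr_K},a_{t_Kr_K})}(a_{r_K},\mathtt{refl}_{a_{s_Kr_K}}),\\ \tau_h(\mathbf a)&\mapsto \mathtt{Id}_{[\![A(a_{ph_2})_p]\!]}\bigl(a_{h_2},\ \mathtt{trans}_{a_{e_h}}^{y.[\![A(\mathbf a')]\!]}(a_{h_1})\bigr)\qquad(h\colon A\to K), \end{aligned} $$ where $a'_h=y$ is a new variable and $a'_p=a_{ph_1}$ for $p\in A/\!/\mathcal L$, $p\neq h$, the transport being from $a_{hh_1}$ to $a_{hh_2}$; here $\mathtt{app}[k(\mathbf a)]$ is the iterated application of $k$ to the $a_f$ (to $*\colon\mathbf 1$ if there are none). The type of homotopy $\mathcal L$-structures is $$\mathrm{HStruc}(\mathcal L)=\sum_{K\in NL(\mathcal L)}(K\colon T_K),\qquad T_K=\prod_{f\in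 K/\!/\mathcal L}\bigl(f\colon [\![K_f(pf)_{p\in K_f/\!/\mathcal L}]\!]\bigr)\ \mathcal U^{h(K)},$$ with the sort and arrow symbols serving as variables, $T_K=\mathbf 1\to\mathcal U^{h(K)}$ if $K/\!/\mathcal L=\varnothing$, and the empty sum being $\mathbf 0$. Contexts are interpreted by $[\![\varnothing]\!]=(\mathcal M\colon\mathrm{HStruc}(\mathcal L))$ and $[\![\Gamma,x\colon K]\!]=[\![\Gamma]\!],x\colon[\![K]\!]$, with $K^{\mathcal M}$ the component of $\mathcal M$ at $K$. Formulas are interpreted by $\bot\mapsto\mathbf 0$, $\top\mapsto\mathbf 1$, $\phi\wedge\psi\mapsto[\![\phi]\!]\times[\![\psi]\!]$, $\phi\vee\psi\mapsto\|[\![\phi]\!]+[\![\psi]\!]\|$, $\phi\to\psi\mapsto[\![\phi]\!]\to[\![\psi]\!]$, $\forall x\colon K.\phi\mapsto\Pi(x\colon[\![K]\!])\,[\![\phi]\!]$, $\exists x\colon K.\phi\mapsto\|\Sigma(x\colon[\![K]\!])\,[\![\phi]\!]\|$. The judgments $\Gamma\ \mathbf{ok}$, $\Gamma\vdash K\ \mathbf{Sort}$,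 $\Gamma\vdash x\colon K$, $\Gamma\vdash\phi\ \mathbf{formula}$ are sent to $[\![\Gamma]\!]\ \mathbf{ok}$, $[\![\Gamma]\!]\vdash[\![K]\!]\ \mathbf{Type}$, $[\![\Gamma]\!]\vdash x\colon[\![K]\!]$, $[\![\Gamma]\!]\vdash[\![\phi]\!]\ \mathbf{Type}$. -/

import Mathlib

/-! # Homotopy type theory

Raw expressions with de Bruijn indices (so expressions are taken up to renaming of bound variables),
contexts as lists of expressions whose head is the most recent declaration, and a derivability
predicate on judgments: intensional Martin-Löf type theory with `Π`, `Σ`, `Id`, `1`, `0`, `+`,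
a univalent universe à la Tarski and propositional truncation. -/

namespace HoTT

/-- Raw type and term expressions. The number of variables bound in an argument is indicated. -/
inductive Expr : Type
  | var (i : ℕ)
  /-- the universe `U` and its reflector `El` -/
  | univ
  | el (a : Expr)
  /-- `Π (x : A), B`, with `B` binding one variable -/
  | pi (A B : Expr)
  | lam (A b : Expr)
  | app (f a : Expr)
  /-- `Σ (x : A), B`, with `B` binding one variable -/
  | sigma (A B : Expr)
  | pair (a b : Expr)
  | fst (p : Expr)
  | snd (p : Expr)
  /-- `Id_A (a, b)` -/
  | id (A a b : Expr)
  | refl (a : Expr)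
  /-- path induction; the motive `C` binds `x, y, p` and `d` binds one variable -/
  | idrec (C d a b p : Expr)
  | unit
  | star
  /-- induction on `1`; the motive `C` binds one variable -/
  | unitrec (C c t : Expr)
  | empty
  /-- induction on `0`; the motive `C` binds one variable -/
  | emptyrec (C t : Expr)
  | sum (A B : Expr)
  | inl (a : Expr)
  | inr (b : Expr)
  /-- induction on `A + B`; `C`, `l`, `r` bind one variable each -/
  | sumrec (C l r t : Expr)
  /-- propositional truncation `‖A‖`, its point and path constructors, and its recursor:
  `truncrec B q f t : B` for `q` a proof that `B` is a mere proposition, `f : A → B`, `t : ‖A‖` -/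
  | trunc (A : Expr)
  | tin (a : Expr)
  | squash (a b : Expr)
  | truncrec (B q f t : Expr)
  /-- codes in the universe; the second argument of `cpi` and `csigma` binds one variable -/
  | cpi (a b : Expr)
  | csigma (a b : Expr)
  | cid (a t u : Expr)
  | cunit
  | cempty
  | csum (a b : Expr)
  | ctrunc (a : Expr)
  /-- the univalence axiom -/
  | ua

namespace Expr

/-- Extension of a renaming under a binder. -/
def upr (ρ : ℕ → ℕ) : ℕ → ℕ
  | 0 => 0
  | i + 1 => ρ i + 1

def rename (ρ : ℕ → ℕ) : Expr → Expr
  | var i => var (ρ i)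
  | univ => univ
  | el a => el (a.rename ρ)
  | pi A B => pi (A.rename ρ) (B.rename (upr ρ))
  | lam A b => lam (A.rename ρ) (b.rename (upr ρ))
  | app f a => app (f.rename ρ) (a.rename ρ)
  | sigma A B => sigma (A.rename ρ) (B.rename (upr ρ))
  | pair a b => pair (a.rename ρ) (b.rename ρ)
  | fst p => fst (p.rename ρ)
  | snd p => snd (p.rename ρ)
  | id A a b => id (A.rename ρ) (a.rename ρ) (b.rename ρ)
  | refl a => refl (a.rename ρ)
  | idrec C d a b p => idrec (C.rename (upr (upr (upr ρ)))) (d.rename (upr ρ))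
      (a.rename ρ) (b.rename ρ) (p.rename ρ)
  | unit => unit
  | star => star
  | unitrec C c t => unitrec (C.rename (upr ρ)) (c.rename ρ) (t.rename ρ)
  | empty => empty
  | emptyrec C t => emptyrec (C.rename (upr ρ)) (t.rename ρ)
  | sum A B => sum (A.rename ρ) (B.rename ρ)
  | inl a => inl (a.rename ρ)
  | inr b => inr (b.rename ρ)
  | sumrec C l r t => sumrec (C.rename (upr ρ)) (l.rename (upr ρ)) (r.rename (upr ρ)) (t.rename ρ)
  | trunc A => trunc (A.rename ρ)
  | tin a => tin (a.rename ρ)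
  | squash a b => squash (a.rename ρ) (b.rename ρ)
  | truncrec B q f t => truncrec (B.rename ρ) (q.rename ρ) (f.rename ρ) (t.rename ρ)
  | cpi a b => cpi (a.rename ρ) (b.rename (upr ρ))
  | csigma a b => csigma (a.rename ρ) (b.rename (upr ρ))
  | cid a t u => cid (a.rename ρ) (t.rename ρ) (u.rename ρ)
  | cunit => cunit
  | cempty => cempty
  | csum a b => csum (a.rename ρ) (b.rename ρ)
  | ctrunc a => ctrunc (a.rename ρ)
  | ua => ua

/-- Weakening by one variable. -/
def lift (e : Expr) : Expr := e.rename Nat.succ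

/-- Extension of a substitution under a binder. -/
def ups (σ : ℕ → Expr) : ℕ → Expr
  | 0 => var 0
  | i + 1 => (σ i).lift

/-- Simultaneous (capture-avoiding) substitution. -/
def subst (σ : ℕ → Expr) : Expr → Expr
  | var i => σ i
  | univ => univ
  | el a => el (a.subst σ)
  | pi A B => pi (A.subst σ) (B.subst (ups σ))
  | lam A b => lam (A.subst σ) (b.subst (ups σ))
  | app f a => app (f.subst σ) (a.subst σ)
  | sigma A B => sigma (A.subst σ) (B.subst (ups σ))
  | pair a b => pair (a.subst σ) (b.subst σ)
  | fst p => fst (p.subst σ)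
  | snd p => snd (p.subst σ)
  | id A a b => id (A.subst σ) (a.subst σ) (b.subst σ)
  | refl a => refl (a.subst σ)
  | idrec C d a b p => idrec (C.subst (ups (ups (ups σ)))) (d.subst (ups σ))
      (a.subst σ) (b.subst σ) (p.subst σ)
  | unit => unit
  | star => star
  | unitrec C c t => unitrec (C.subst (ups σ)) (c.subst σ) (t.subst σ)
  | empty => empty
  | emptyrec C t => emptyrec (C.subst (ups σ)) (t.subst σ)
  | sum A B => sum (A.subst σ) (B.subst σ)
  | inl a => inl (a.subst σ)
  | inr b => inr (b.subst σ)
  | sumrec C l r t => sumrec (C.subst (ups σ)) (l.subst (ups σ)) (r.subst (ups σ)) (t.subst σ)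
  | trunc A => trunc (A.subst σ)
  | tin a => tin (a.subst σ)
  | squash a b => squash (a.subst σ) (b.subst σ)
  | truncrec B q f t => truncrec (B.subst σ) (q.subst σ) (f.subst σ) (t.subst σ)
  | cpi a b => cpi (a.subst σ) (b.subst (ups σ))
  | csigma a b => csigma (a.subst σ) (b.subst (ups σ))
  | cid a t u => cid (a.subst σ) (t.subst σ) (u.subst σ)
  | cunit => cunit
  | cempty => cempty
  | csum a b => csum (a.subst σ) (b.subst σ)
  | ctrunc a => ctrunc (a.subst σ)
  | ua => ua

/-- `B[a/x]` for `B` binding one variable `x`. -/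
def inst (B a : Expr) : Expr :=
  B.subst fun
    | 0 => a
    | i + 1 => var i

/-- `C[a/x, b/y, p/z]` for `C` binding the variables `x, y, z` (in this order). -/
def inst3 (C a b p : Expr) : Expr :=
  C.subst fun
    | 0 => p
    | 1 => b
    | 2 => a
    | i + 3 => var i

/-- `C[x/x, x/y, refl_x/z]`, binding the variable `x`, for `C` binding `x, y, z`. -/
def diag (C : Expr) : Expr :=
  C.subst fun
    | 0 => refl (var 0)
    | 1 => var 0
    | 2 => var 0
    | i + 3 => var (i + 1)

/-- `C[e/x]`, binding one variable, for `C` binding one variable `x` and `e` an expression in which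
one variable is bound as well. -/
def instUnder (C e : Expr) : Expr :=
  C.subst fun
    | 0 => e
    | i + 1 => var (i + 1)

/-- Non-dependent functions. -/
def arrow (A B : Expr) : Expr := pi A B.lift

/-- Non-dependent pairs. -/
def prod (A B : Expr) : Expr := sigma A B.lift

/-- `trans_p^{x.P} (t)`, the transport of `t : P[a/x]` along `p : Id (a, b)` (here `P` binds one
variable): the path induction with motive `x, y, q. P[x] → P[y]` and base case the identity function,
applied to `t`. -/
def transport (P a b p t : Expr) : Expr :=
  app
    (idrec
      (arrow
        (P.rename fun
          | 0 => 2
          | i + 1 => i + 3)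
        (P.rename fun
          | 0 => 1
          | i + 1 => i + 3))
      (lam P (var 0)) a b p)
    t

/-- The type expressing that `A` is of `h`-level `n` (contractible for `n = 0`). -/
def isOfHLevel : ℕ → Expr → Expr
  | 0, A => sigma A (pi A.lift (id A.lift.lift (var 1) (var 0)))
  | n + 1, A => pi A (pi A.lift (isOfHLevel n (id A.lift.lift (var 1) (var 0))))

/-- The type expressing that `A` is a mere proposition. -/
def isMereProp (A : Expr) : Expr := pi A (pi A.lift (id A.lift.lift (var 1) (var 0)))

open Classical in
/-- `U^m`, the types of `h`-level `m` in `U`, with `U^∞ = U`. -/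
noncomputable def typesOfHLevel (m : ℕ∞) : Expr :=
  if m = ⊤ then univ else sigma univ (isOfHLevel m.toNat (el (var 0)))

open Classical in
/-- The type underlying a term of `U^m`. -/
noncomputable def elOfHLevel (m : ℕ∞) (a : Expr) : Expr :=
  if m = ⊤ then el a else el (fst a)

/-- `f : A → B` is an equivalence: it has a right inverse and a left inverse. -/
def isEquiv (A B f : Expr) : Expr :=
  prod
    (sigma (arrow B A)
      (pi B.lift (id B.lift.lift (app f.lift.lift (app (var 1) (var 0))) (var 0))))
    (sigma (arrow B A)
      (pi A.lift (id A.lift.lift (app (var 1) (app f.lift.lift (var 0))) (var 0))))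

/-- The type of equivalences from `A` to `B`. -/
def equiv (A B : Expr) : Expr := sigma (arrow A B) (isEquiv A.lift B.lift (var 0))

/-- The identity equivalence. -/
def idEquiv (A : Expr) : Expr :=
  pair (lam A (var 0))
    (pair (pair (lam A (var 0)) (lam A (refl (var 0))))
      (pair (lam A (var 0)) (lam A (refl (var 0)))))

/-- The equivalence between `El a` and `El b` induced by `p : Id_U (a, b)`. -/
def idToEquiv (a b p : Expr) : Expr :=
  idrec (equiv (el (var 2)) (el (var 1))) (idEquiv (el (var 0))) a b p

/-- The univalence axiom for `U`: for `a, b : U` the map `Id_U (a, b) → (El a ≃ El b)` is an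
equivalence. -/
def univalence : Expr :=
  pi univ (pi univ
    (isEquiv (id univ (var 1) (var 0)) (equiv (el (var 1)) (el (var 0)))
      (lam (id univ (var 1) (var 0)) (idToEquiv (var 2) (var 1) (var 0)))))

end Expr

open _root_.HoTT.Expr

/-- Judgments: `Γ ok`, `Γ ⊢ A Type`, `Γ ⊢ A ≡ B Type`, `Γ ⊢ a : A`, `Γ ⊢ a ≡ b : A`. -/
inductive Judgment : Type
  | ok (Γ : List Expr)
  | ty (Γ : List Expr) (A : Expr)
  | tyEq (Γ : List Expr) (A B : Expr)
  | tm (Γ : List Expr) (a A : Expr)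
  | tmEq (Γ : List Expr) (a b A : Expr)

open Judgment

/-- The derivable judgments of homotopy type theory. -/
inductive Derivable : Judgment → Prop
  -- contexts, variables, weakening
  | nil : Derivable (ok [])
  | cons {Γ A} : Derivable (ok Γ) → Derivable (ty Γ A) → Derivable (ok (A :: Γ))
  | var {Γ A} : Derivable (ok (A :: Γ)) → Derivable (tm (A :: Γ) (var 0) A.lift)
  | wkTy {Γ A B} : Derivable (ok (B :: Γ)) → Derivable (ty Γ A) → Derivable (ty (B :: Γ) A.lift)
  | wkTyEq {Γ A A' B} : Derivable (ok (B :: Γ)) → Derivable (tyEq Γ A A') →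
      Derivable (tyEq (B :: Γ) A.lift A'.lift)
  | wkTm {Γ a A B} : Derivable (ok (B :: Γ)) → Derivable (tm Γ a A) →
      Derivable (tm (B :: Γ) a.lift A.lift)
  | wkTmEq {Γ a a' A B} : Derivable (ok (B :: Γ)) → Derivable (tmEq Γ a a' A) →
      Derivable (tmEq (B :: Γ) a.lift a'.lift A.lift)
  -- definitional equality
  | tyRefl {Γ A} : Derivable (ty Γ A) → Derivable (tyEq Γ A A)
  | tySymm {Γ A B} : Derivable (tyEq Γ A B) → Derivable (tyEq Γ B A)
  | tyTrans {Γ A B C} : Derivable (tyEq Γ A B) → Derivable (tyEq Γ B C) → Derivable (tyEq Γ A C)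
  | tmRefl {Γ a A} : Derivable (tm Γ a A) → Derivable (tmEq Γ a a A)
  | tmSymm {Γ a b A} : Derivable (tmEq Γ a b A) → Derivable (tmEq Γ b a A)
  | tmTrans {Γ a b c A} : Derivable (tmEq Γ a b A) → Derivable (tmEq Γ b c A) →
      Derivable (tmEq Γ a c A)
  | conv {Γ a A B} : Derivable (tm Γ a A) → Derivable (tyEq Γ A B) → Derivable (tm Γ a B)
  | convEq {Γ a b A B} : Derivable (tmEq Γ a b A) → Derivable (tyEq Γ A B) →
      Derivable (tmEq Γ a b B)
  -- dependent functions
  | piForm {Γ A B} : Derivable (ty Γ A) → Derivable (ty (A :: Γ) B) → Derivable (ty Γ (pi A B))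
  | piFormEq {Γ A A' B B'} : Derivable (ty Γ A) → Derivable (tyEq Γ A A') →
      Derivable (tyEq (A :: Γ) B B') → Derivable (tyEq Γ (pi A B) (pi A' B'))
  | piIntro {Γ A B b} : Derivable (ty Γ A) → Derivable (tm (A :: Γ) b B) →
      Derivable (tm Γ (lam A b) (pi A B))
  | piIntroEq {Γ A A' B b b'} : Derivable (ty Γ A) → Derivable (tyEq Γ A A') →
      Derivable (tmEq (A :: Γ) b b' B) → Derivable (tmEq Γ (lam A b) (lam A' b') (pi A B))
  | piElim {Γ A B f a} : Derivable (tm Γ f (pi A B)) → Derivable (tm Γ a A) →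
      Derivable (tm Γ (app f a) (B.inst a))
  | piElimEq {Γ A B f f' a a'} : Derivable (tmEq Γ f f' (pi A B)) → Derivable (tmEq Γ a a' A) →
      Derivable (tmEq Γ (app f a) (app f' a') (B.inst a))
  | piBeta {Γ A B b a} : Derivable (tm (A :: Γ) b B) → Derivable (tm Γ a A) →
      Derivable (tmEq Γ (app (lam A b) a) (b.inst a) (B.inst a))
  | piEta {Γ A B f} : Derivable (tm Γ f (pi A B)) →
      Derivable (tmEq Γ f (lam A (app f.lift (var 0))) (pi A B))
  -- dependent pairs
  | sigmaForm {Γ A B} : Derivable (ty Γ A) → Derivable (ty (A :: Γ) B) →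
      Derivable (ty Γ (sigma A B))
  | sigmaFormEq {Γ A A' B B'} : Derivable (ty Γ A) → Derivable (tyEq Γ A A') →
      Derivable (tyEq (A :: Γ) B B') → Derivable (tyEq Γ (sigma A B) (sigma A' B'))
  | sigmaIntro {Γ A B a b} : Derivable (ty (A :: Γ) B) → Derivable (tm Γ a A) →
      Derivable (tm Γ b (B.inst a)) → Derivable (tm Γ (pair a b) (sigma A B))
  | sigmaIntroEq {Γ A B a a' b b'} : Derivable (ty (A :: Γ) B) → Derivable (tmEq Γ a a' A) →
      Derivable (tmEq Γ b b' (B.inst a)) → Derivable (tmEq Γ (pair a b) (pair a' b') (sigma A B))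
  | sigmaFst {Γ A B p} : Derivable (tm Γ p (sigma A B)) → Derivable (tm Γ (fst p) A)
  | sigmaFstEq {Γ A B p p'} : Derivable (tmEq Γ p p' (sigma A B)) →
      Derivable (tmEq Γ (fst p) (fst p') A)
  | sigmaSnd {Γ A B p} : Derivable (tm Γ p (sigma A B)) → Derivable (tm Γ (snd p) (B.inst (fst p)))
  | sigmaSndEq {Γ A B p p'} : Derivable (tmEq Γ p p' (sigma A B)) →
      Derivable (tmEq Γ (snd p) (snd p') (B.inst (fst p)))
  | sigmaBetaFst {Γ A B a b} : Derivable (ty (A :: Γ) B) → Derivable (tm Γ a A) →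
      Derivable (tm Γ b (B.inst a)) → Derivable (tmEq Γ (fst (pair a b)) a A)
  | sigmaBetaSnd {Γ A B a b} : Derivable (ty (A :: Γ) B) → Derivable (tm Γ a A) →
      Derivable (tm Γ b (B.inst a)) → Derivable (tmEq Γ (snd (pair a b)) b (B.inst a))
  | sigmaEta {Γ A B p} : Derivable (tm Γ p (sigma A B)) →
      Derivable (tmEq Γ p (pair (fst p) (snd p)) (sigma A B))
  -- identity types
  | idForm {Γ A a b} : Derivable (ty Γ A) → Derivable (tm Γ a A) → Derivable (tm Γ b A) →
      Derivable (ty Γ (id A a b))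
  | idFormEq {Γ A A' a a' b b'} : Derivable (tyEq Γ A A') → Derivable (tmEq Γ a a' A) →
      Derivable (tmEq Γ b b' A) → Derivable (tyEq Γ (id A a b) (id A' a' b'))
  | idIntro {Γ A a} : Derivable (tm Γ a A) → Derivable (tm Γ (refl a) (id A a a))
  | idIntroEq {Γ A a a'} : Derivable (tmEq Γ a a' A) →
      Derivable (tmEq Γ (refl a) (refl a') (id A a a))
  | idElim {Γ A C d a b p} : Derivable (ty Γ A) →
      Derivable (ty (id A.lift.lift (var 1) (var 0) :: A.lift :: A :: Γ) C) →
      Derivable (tm (A :: Γ) d C.diag) →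
      Derivable (tm Γ a A) → Derivable (tm Γ b A) → Derivable (tm Γ p (id A a b)) →
      Derivable (tm Γ (idrec C d a b p) (C.inst3 a b p))
  | idElimEq {Γ A C C' d d' a a' b b' p p'} : Derivable (ty Γ A) →
      Derivable (tyEq (id A.lift.lift (var 1) (var 0) :: A.lift :: A :: Γ) C C') →
      Derivable (tmEq (A :: Γ) d d' C.diag) →
      Derivable (tmEq Γ a a' A) → Derivable (tmEq Γ b b' A) →
      Derivable (tmEq Γ p p' (id A a b)) →
      Derivable (tmEq Γ (idrec C d a b p) (idrec C' d' a' b' p') (C.inst3 a b p))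
  | idBeta {Γ A C d a} : Derivable (ty Γ A) →
      Derivable (ty (id A.lift.lift (var 1) (var 0) :: A.lift :: A :: Γ) C) →
      Derivable (tm (A :: Γ) d C.diag) → Derivable (tm Γ a A) →
      Derivable (tmEq Γ (idrec C d a a (refl a)) (d.inst a) (C.inst3 a a (refl a)))
  -- the unit type
  | unitForm {Γ} : Derivable (ok Γ) → Derivable (ty Γ unit)
  | unitIntro {Γ} : Derivable (ok Γ) → Derivable (tm Γ star unit)
  | unitElim {Γ C c t} : Derivable (ty (unit :: Γ) C) → Derivable (tm Γ c (C.inst star)) →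
      Derivable (tm Γ t unit) → Derivable (tm Γ (unitrec C c t) (C.inst t))
  | unitElimEq {Γ C C' c c' t t'} : Derivable (tyEq (unit :: Γ) C C') →
      Derivable (tmEq Γ c c' (C.inst star)) → Derivable (tmEq Γ t t' unit) →
      Derivable (tmEq Γ (unitrec C c t) (unitrec C' c' t') (C.inst t))
  | unitBeta {Γ C c} : Derivable (ty (unit :: Γ) C) → Derivable (tm Γ c (C.inst star)) →
      Derivable (tmEq Γ (unitrec C c star) c (C.inst star))
  -- the empty type
  | emptyForm {Γ} : Derivable (ok Γ) → Derivable (ty Γ empty)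
  | emptyElim {Γ C t} : Derivable (ty (empty :: Γ) C) → Derivable (tm Γ t empty) →
      Derivable (tm Γ (emptyrec C t) (C.inst t))
  | emptyElimEq {Γ C C' t t'} : Derivable (tyEq (empty :: Γ) C C') →
      Derivable (tmEq Γ t t' empty) →
      Derivable (tmEq Γ (emptyrec C t) (emptyrec C' t') (C.inst t))
  -- coproducts
  | sumForm {Γ A B} : Derivable (ty Γ A) → Derivable (ty Γ B) → Derivable (ty Γ (sum A B))
  | sumFormEq {Γ A A' B B'} : Derivable (tyEq Γ A A') → Derivable (tyEq Γ B B') →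
      Derivable (tyEq Γ (sum A B) (sum A' B'))
  | sumInl {Γ A B a} : Derivable (tm Γ a A) → Derivable (ty Γ B) →
      Derivable (tm Γ (inl a) (sum A B))
  | sumInlEq {Γ A B a a'} : Derivable (tmEq Γ a a' A) → Derivable (ty Γ B) →
      Derivable (tmEq Γ (inl a) (inl a') (sum A B))
  | sumInr {Γ A B b} : Derivable (ty Γ A) → Derivable (tm Γ b B) →
      Derivable (tm Γ (inr b) (sum A B))
  | sumInrEq {Γ A B b b'} : Derivable (ty Γ A) → Derivable (tmEq Γ b b' B) →
      Derivable (tmEq Γ (inr b) (inr b') (sum A B))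
  | sumElim {Γ A B C l r t} : Derivable (ty (sum A B :: Γ) C) →
      Derivable (tm (A :: Γ) l (C.instUnder (inl (var 0)))) →
      Derivable (tm (B :: Γ) r (C.instUnder (inr (var 0)))) →
      Derivable (tm Γ t (sum A B)) → Derivable (tm Γ (sumrec C l r t) (C.inst t))
  | sumElimEq {Γ A B C C' l l' r r' t t'} : Derivable (tyEq (sum A B :: Γ) C C') →
      Derivable (tmEq (A :: Γ) l l' (C.instUnder (inl (var 0)))) →
      Derivable (tmEq (B :: Γ) r r' (C.instUnder (inr (var 0)))) →
      Derivable (tmEq Γ t t' (sum A B)) →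
      Derivable (tmEq Γ (sumrec C l r t) (sumrec C' l' r' t') (C.inst t))
  | sumBetaInl {Γ A B C l r a} : Derivable (ty (sum A B :: Γ) C) →
      Derivable (tm (A :: Γ) l (C.instUnder (inl (var 0)))) →
      Derivable (tm (B :: Γ) r (C.instUnder (inr (var 0)))) →
      Derivable (tm Γ a A) →
      Derivable (tmEq Γ (sumrec C l r (inl a)) (l.inst a) (C.inst (inl a)))
  | sumBetaInr {Γ A B C l r b} : Derivable (ty (sum A B :: Γ) C) →
      Derivable (tm (A :: Γ) l (C.instUnder (inl (var 0)))) →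
      Derivable (tm (B :: Γ) r (C.instUnder (inr (var 0)))) →
      Derivable (tm Γ b B) →
      Derivable (tmEq Γ (sumrec C l r (inr b)) (r.inst b) (C.inst (inr b)))
  -- propositional truncation
  | truncForm {Γ A} : Derivable (ty Γ A) → Derivable (ty Γ (trunc A))
  | truncFormEq {Γ A A'} : Derivable (tyEq Γ A A') → Derivable (tyEq Γ (trunc A) (trunc A'))
  | truncIntro {Γ A a} : Derivable (tm Γ a A) → Derivable (tm Γ (tin a) (trunc A))
  | truncIntroEq {Γ A a a'} : Derivable (tmEq Γ a a' A) →
      Derivable (tmEq Γ (tin a) (tin a') (trunc A))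
  | truncPath {Γ A a b} : Derivable (tm Γ a (trunc A)) → Derivable (tm Γ b (trunc A)) →
      Derivable (tm Γ (squash a b) (id (trunc A) a b))
  | truncPathEq {Γ A a a' b b'} : Derivable (tmEq Γ a a' (trunc A)) →
      Derivable (tmEq Γ b b' (trunc A)) →
      Derivable (tmEq Γ (squash a b) (squash a' b') (id (trunc A) a b))
  | truncElim {Γ A B q f t} : Derivable (ty Γ B) → Derivable (tm Γ q (isMereProp B)) →
      Derivable (tm Γ f (arrow A B)) → Derivable (tm Γ t (trunc A)) →
      Derivable (tm Γ (truncrec B q f t) B)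
  | truncElimEq {Γ A B B' q q' f f' t t'} : Derivable (tyEq Γ B B') →
      Derivable (tmEq Γ q q' (isMereProp B)) → Derivable (tmEq Γ f f' (arrow A B)) →
      Derivable (tmEq Γ t t' (trunc A)) →
      Derivable (tmEq Γ (truncrec B q f t) (truncrec B' q' f' t') B)
  | truncBeta {Γ A B q f a} : Derivable (ty Γ B) → Derivable (tm Γ q (isMereProp B)) →
      Derivable (tm Γ f (arrow A B)) → Derivable (tm Γ a A) →
      Derivable (tmEq Γ (truncrec B q f (tin a)) (app f a) B)
  -- the universe
  | univForm {Γ} : Derivable (ok Γ) → Derivable (ty Γ univ)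
  | elForm {Γ a} : Derivable (tm Γ a univ) → Derivable (ty Γ (el a))
  | elFormEq {Γ a a'} : Derivable (tmEq Γ a a' univ) → Derivable (tyEq Γ (el a) (el a'))
  | cpi {Γ a b} : Derivable (tm Γ a univ) → Derivable (tm (el a :: Γ) b univ) →
      Derivable (tm Γ (cpi a b) univ)
  | cpiEq {Γ a a' b b'} : Derivable (tm Γ a univ) → Derivable (tmEq Γ a a' univ) →
      Derivable (tmEq (el a :: Γ) b b' univ) → Derivable (tmEq Γ (cpi a b) (cpi a' b') univ)
  | elPi {Γ a b} : Derivable (tm Γ a univ) → Derivable (tm (el a :: Γ) b univ) →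
      Derivable (tyEq Γ (el (cpi a b)) (pi (el a) (el b)))
  | csigma {Γ a b} : Derivable (tm Γ a univ) → Derivable (tm (el a :: Γ) b univ) →
      Derivable (tm Γ (csigma a b) univ)
  | csigmaEq {Γ a a' b b'} : Derivable (tm Γ a univ) → Derivable (tmEq Γ a a' univ) →
      Derivable (tmEq (el a :: Γ) b b' univ) → Derivable (tmEq Γ (csigma a b) (csigma a' b') univ)
  | elSigma {Γ a b} : Derivable (tm Γ a univ) → Derivable (tm (el a :: Γ) b univ) →
      Derivable (tyEq Γ (el (csigma a b)) (sigma (el a) (el b)))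
  | cid {Γ a t u} : Derivable (tm Γ a univ) → Derivable (tm Γ t (el a)) →
      Derivable (tm Γ u (el a)) → Derivable (tm Γ (cid a t u) univ)
  | cidEq {Γ a a' t t' u u'} : Derivable (tmEq Γ a a' univ) → Derivable (tmEq Γ t t' (el a)) →
      Derivable (tmEq Γ u u' (el a)) → Derivable (tmEq Γ (cid a t u) (cid a' t' u') univ)
  | elId {Γ a t u} : Derivable (tm Γ a univ) → Derivable (tm Γ t (el a)) →
      Derivable (tm Γ u (el a)) → Derivable (tyEq Γ (el (cid a t u)) (id (el a) t u))
  | cunit {Γ} : Derivable (ok Γ) → Derivable (tm Γ cunit univ)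
  | elUnit {Γ} : Derivable (ok Γ) → Derivable (tyEq Γ (el cunit) unit)
  | cempty {Γ} : Derivable (ok Γ) → Derivable (tm Γ cempty univ)
  | elEmpty {Γ} : Derivable (ok Γ) → Derivable (tyEq Γ (el cempty) empty)
  | csum {Γ a b} : Derivable (tm Γ a univ) → Derivable (tm Γ b univ) →
      Derivable (tm Γ (csum a b) univ)
  | csumEq {Γ a a' b b'} : Derivable (tmEq Γ a a' univ) → Derivable (tmEq Γ b b' univ) →
      Derivable (tmEq Γ (csum a b) (csum a' b') univ)
  | elSum {Γ a b} : Derivable (tm Γ a univ) → Derivable (tm Γ b univ) →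
      Derivable (tyEq Γ (el (csum a b)) (sum (el a) (el b)))
  | ctrunc {Γ a} : Derivable (tm Γ a univ) → Derivable (tm Γ (ctrunc a) univ)
  | ctruncEq {Γ a a'} : Derivable (tmEq Γ a a' univ) →
      Derivable (tmEq Γ (ctrunc a) (ctrunc a') univ)
  | elTrunc {Γ a} : Derivable (tm Γ a univ) → Derivable (tyEq Γ (el (ctrunc a)) (trunc (el a)))
  -- univalence
  | ua {Γ} : Derivable (ok Γ) → Derivable (tm Γ ua univalence)

end HoTT

/-! # Signatures -/

namespace FOLIso

universe u v

mutual

/-- Symbols for sorts: non-logical sorts, isomorphism sorts `≅_K`, reflexivity sorts `ρ_K` and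
transport sorts `τ_f`. -/
inductive Ob (O : Type u) (M : Type v) : Type (max u v)
  | base (A : O)
  | iso (K : Ob O M)
  | rho (K : Ob O M)
  | tau (f : Mor O M)

/-- Symbols for (non-identity) arrows: non-logical arrows, `s_K`, `t_K`, `r_K`, `f₁`, `f₂`, `e_f`. -/
inductive Mor (O : Type u) (M : Type v) : Type (max u v)
  | base (m : M)
  | src (K : Ob O M)
  | tgt (K : Ob O M)
  | rfl (K : Ob O M)
  | fst (f : Mor O M)
  | snd (f : Mor O M)
  | path (f : Mor O M)

end

/-- The non-logical sort symbols. -/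
def Ob.NonLogical {O : Type u} {M : Type v} : Ob O M → Prop
  | .base _ => True
  | _ => False

/-- A FOLDS signature over `(Ob, Mor)`: an inverse category with a proper order.

The category is given by its objects `ob` and its *non-identity* arrows `mor`, with composition
`comp g f = g ∘ f`. In an inverse category (skeletal, no non-identity endomorphisms) a composite of
two non-identity arrows is never an identity, so nothing is lost; conversely, adjoining identities to
data as below gives a skeletal category without non-identity endomorphisms. The values of `dom`,
`cod`, `comp` outside `mor` (or on non-composable arrows) carry no information. -/
structure FOLDSSignature (O : Type u) (M : Type v) where
  ob : Set (Ob O M)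
  mor : Set (Mor O M)
  dom : Mor O M → Ob O M
  cod : Mor O M → Ob O M
  comp : Mor O M → Mor O M → Mor O M
  dom_mem : ∀ f ∈ mor, dom f ∈ ob
  cod_mem : ∀ f ∈ mor, cod f ∈ ob
  comp_mem : ∀ f ∈ mor, ∀ g ∈ mor, cod f = dom g → comp g f ∈ mor
  dom_comp : ∀ f ∈ mor, ∀ g ∈ mor, cod f = dom g → dom (comp g f) = dom f
  cod_comp : ∀ f ∈ mor, ∀ g ∈ mor, cod f = dom g → cod (comp g f) = cod g
  assoc : ∀ f ∈ mor, ∀ g ∈ mor, ∀ k ∈ mor, cod f = dom g → cod g = dom k →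
    comp k (comp g f) = comp (comp k g) f
  no_endo : ∀ f ∈ mor, dom f ≠ cod f
  finite_fanout : ∀ K ∈ ob, {f ∈ mor | dom f = K}.Finite
  /-- the order on objects -/
  obLt : Ob O M → Ob O M → Prop
  obLt_irrefl : ∀ K ∈ ob, ¬ obLt K K
  obLt_trans : ∀ K ∈ ob, ∀ K' ∈ ob, ∀ K'' ∈ ob, obLt K K' → obLt K' K'' → obLt K K''
  cod_obLt_dom : ∀ f ∈ mor, obLt (cod f) (dom f)
  /-- the order on arrows -/
  morLt : Mor O M → Mor O M → Prop
  morLt_irrefl : ∀ f ∈ mor, ¬ morLt f f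
  morLt_trans : ∀ f ∈ mor, ∀ g ∈ mor, ∀ k ∈ mor, morLt f g → morLt g k → morLt f k
  morLt_of_cod : ∀ f ∈ mor, ∀ g ∈ mor, obLt (cod f) (cod g) → morLt f g
  /-- the non-logical sorts, and the arrows out of a given sort, are listed in increasing order, so
  the orders are total on these sets -/
  obLt_total : ∀ K ∈ ob, ∀ K' ∈ ob, K.NonLogical → K'.NonLogical → K ≠ K' → obLt K K' ∨ obLt K' K
  morLt_total : ∀ f ∈ mor, ∀ g ∈ mor, dom f = dom g → f ≠ g → morLt f g ∨ morLt g f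

namespace FOLDSSignature

variable {O : Type u} {M : Type v} (L : FOLDSSignature O M)

/-- `K // L`, the set of non-identity arrows with domain `K`. -/
def out (K : Ob O M) : Set (Mor O M) := {f ∈ L.mor | L.dom f = K}

/-- The non-identity arrows from `K` to `K'`. -/
def hom (K K' : Ob O M) : Set (Mor O M) := {f ∈ L.mor | L.dom f = K ∧ L.cod f = K'}

/-- The top-level arrows of `K`: those non-identity arrows with domain `K` that are not a composite of
two non-identity arrows. -/
def top (K : Ob O M) : Set (Mor O M) :=
  {f ∈ L.out K | ¬ ∃ k ∈ L.mor, ∃ g ∈ L.mor, L.cod k = L.dom g ∧ f = L.comp g k}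

/-- The set `NL(L)` of non-logical sorts. -/
def nonLogical : Set (Ob O M) := {K ∈ L.ob | K.NonLogical}

def EssentiallyFinite : Prop := L.nonLogical.Finite

/-- The number of sorts on which `K` depends. -/
noncomputable def rank (K : Ob O M) : ℕ := (L.cod '' L.out K).ncard

theorem rank_lt {f : Mor O M} (hf : f ∈ L.mor) : L.rank (L.cod f) < L.rank (L.dom f) := by
  apply Set.ncard_lt_ncard
  · refine ⟨?_, fun hsub => ?_⟩
    · rintro _ ⟨g, ⟨hg, hgd⟩, rfl⟩
      exact ⟨L.comp g f, ⟨L.comp_mem f hf g hg hgd.symm, L.dom_comp f hf g hg hgd.symm⟩,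
        L.cod_comp f hf g hg hgd.symm⟩
    · obtain ⟨g, ⟨hg, hgd⟩, hgc⟩ := hsub ⟨f, ⟨hf, rfl⟩, rfl⟩
      exact L.no_endo g hg (hgd.trans hgc.symm)
  · exact (L.finite_fanout _ (L.dom_mem f hf)).image _

end FOLDSSignature

/-- An `h`-signature. Every signature of first-order logic with isomorphism is an `h`-signature (one
that has all the logical sorts that its `h`-levels allow), with the same sorts, formulas and
structures; the closure under logical sorts plays no role below.

Subtraction in `ℕ∞` satisfies `⊤ - n = ⊤`. -/
structure HSignature (O : Type u) (M : Type v) extends FOLDSSignature O M where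
  h : Ob O M → ℕ∞
  -- isomorphism sorts
  iso_mem : ∀ K, .iso K ∈ ob → K ∈ ob
  iso_level : ∀ K, .iso K ∈ ob → 2 ≤ h K
  iso_top : ∀ K, .iso K ∈ ob → toFOLDSSignature.top (.iso K) = {.src K, .tgt K}
  iso_hom : ∀ K, .iso K ∈ ob → toFOLDSSignature.hom (.iso K) K = {.src K, .tgt K}
  iso_comp : ∀ K, .iso K ∈ ob → ∀ f ∈ toFOLDSSignature.out K, comp f (.src K) = comp f (.tgt K)
  iso_h : ∀ K, .iso K ∈ ob → h (.iso K) = h K - 1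
  -- reflexivity sorts
  rho_mem : ∀ K, .rho K ∈ ob → K ∈ ob
  rho_level : ∀ K, .rho K ∈ ob → 2 ≤ h K
  rho_top : ∀ K, .rho K ∈ ob → toFOLDSSignature.top (.rho K) = {.rfl K}
  rho_hom : ∀ K, .rho K ∈ ob → toFOLDSSignature.hom (.rho K) (.iso K) = {.rfl K}
  rho_comp : ∀ K, .rho K ∈ ob → comp (.src K) (.rfl K) = comp (.tgt K) (.rfl K)
  rho_h : ∀ K, .rho K ∈ ob → h (.rho K) = h K - 2
  -- transport sorts
  tau_mem : ∀ f, .tau f ∈ ob → f ∈ mor ∧ f ∈ toFOLDSSignature.top (dom f)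
  tau_level : ∀ f, .tau f ∈ ob → 2 ≤ h (cod f)
  tau_top : ∀ f, .tau f ∈ ob → toFOLDSSignature.top (.tau f) = {.path f, .fst f, .snd f}
  tau_path : ∀ f, .tau f ∈ ob → cod (.path f) = .iso (cod f)
  tau_fst : ∀ f, .tau f ∈ ob → cod (.fst f) = dom f
  tau_snd : ∀ f, .tau f ∈ ob → cod (.snd f) = dom f
  tau_src : ∀ f, .tau f ∈ ob → comp (.src (cod f)) (.path f) = comp f (.fst f)
  tau_tgt : ∀ f, .tau f ∈ ob → comp (.tgt (cod f)) (.path f) = comp f (.snd f)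
  tau_other : ∀ f, .tau f ∈ ob → ∀ g ∈ toFOLDSSignature.out (dom f), g ≠ f →
    comp g (.fst f) = comp g (.snd f)
  tau_base : ∀ f, .tau f ∈ ob → ∀ q ∈ toFOLDSSignature.out (cod f),
    comp q (comp f (.fst f)) = comp q (comp f (.snd f))
  tau_h : ∀ f, .tau f ∈ ob → h (.tau f) = h (dom f) - 1
  -- only reflexivity and transport sorts may have `h`-level `0`
  h_ne_zero : ∀ K ∈ ob, h K = 0 → (∃ A, K = .rho A) ∨ ∃ f, K = .tau f

open Classical in
/-- The increasing enumeration of a set on which `lt` is a total order, as a list (the empty list if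
there is none). -/
noncomputable def sortedList {α : Type*} (lt : α → α → Prop) (S : Set α) : List α :=
  if H : ∃ l : List α, l.Pairwise lt ∧ ∀ a, a ∈ l ↔ a ∈ S then H.choose else []

namespace FOLDSSignature

variable {O : Type u} {M : Type v} (L : FOLDSSignature O M)

/-- The arrows in `K // L`, in increasing order. -/
noncomputable def outList (K : Ob O M) : List (Mor O M) := sortedList L.morLt (L.out K)

/-- The non-logical sorts, in increasing order. -/
noncomputable def nonLogicalList : List (Ob O M) := sortedList L.obLt L.nonLogical

/-! # The logical type theory of a signature

Variables are de Bruijn indices; a context is a list of sorts whose head is the most recent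
declaration. Freshness of a newly declared variable is automatic, and formulas are represented up to
renaming of bound variables. -/

/-- A sort expression `A (x_f)_{f ∈ A // L}`. -/
structure SortExpr where
  head : Ob O M
  head_mem : head ∈ L.ob
  args : L.out head → ℕ

/-- Renaming of variables in a sort expression. -/
def SortExpr.rename {L : FOLDSSignature O M} (ρ : ℕ → ℕ) (K : L.SortExpr) : L.SortExpr where
  head := K.head
  head_mem := K.head_mem
  args := fun f => ρ (K.args f)

/-- For an arrow `f : K → K_f` and a family `(x_g)_{g ∈ K // L}`, the sort expression
`K_f (x_{p f})_{p ∈ K_f // L}`. -/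
def depSort {K : Ob O M} (x : L.out K → ℕ) (f : L.out K) : L.SortExpr where
  head := L.cod f
  head_mem := L.cod_mem f f.2.1
  args := fun p => x ⟨L.comp p f, L.comp_mem f f.2.1 p p.2.1 p.2.2.symm,
    (L.dom_comp f f.2.1 p p.2.1 p.2.2.symm).trans f.2.2⟩

/-- Formulas. In a quantified formula the body binds one variable. -/
inductive Formula
  | bot
  | top
  | and (φ ψ : Formula)
  | or (φ ψ : Formula)
  | imp (φ ψ : Formula)
  | all (K : L.SortExpr) (φ : Formula)
  | ex (K : L.SortExpr) (φ : Formula)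

/-- Renaming of free variables in a formula. -/
def Formula.rename {L : FOLDSSignature O M} (ρ : ℕ → ℕ) : L.Formula → L.Formula
  | bot => bot
  | top => top
  | and φ ψ => and (φ.rename ρ) (ψ.rename ρ)
  | or φ ψ => or (φ.rename ρ) (ψ.rename ρ)
  | imp φ ψ => imp (φ.rename ρ) (ψ.rename ρ)
  | all K φ => all (K.rename ρ) (φ.rename (HoTT.Expr.upr ρ))
  | ex K φ => ex (K.rename ρ) (φ.rename (HoTT.Expr.upr ρ))

/-- Judgments: `Γ ok`, `Γ ⊢ K Sort`, `Γ ⊢ x : K`, `Γ ⊢ φ formula`. -/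
inductive Judgment
  | ok (Γ : List L.SortExpr)
  | sort (Γ : List L.SortExpr) (K : L.SortExpr)
  | var (Γ : List L.SortExpr) (x : ℕ) (K : L.SortExpr)
  | formula (Γ : List L.SortExpr) (φ : L.Formula)

/-- The derivable judgments of the logical type theory of `L`. A context written `Γ, Δ` is the list
`Δ ++ Γ`, and an expression over `Γ` becomes one over `Γ, Δ` by adding the length of `Δ` to all its
variables. -/
inductive Derivable : L.Judgment → Prop
  | conEmpty : Derivable (.ok [])
  | conExt {Γ K} : Derivable (.ok Γ) → Derivable (.sort Γ K) → Derivable (.ok (K :: Γ))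
  | conWk {Γ Δ K} : Derivable (.ok (Δ ++ Γ)) → Derivable (.sort Γ K) →
      Derivable (.sort (Δ ++ Γ) (K.rename (· + Δ.length)))
  | ax {Γ Δ K} : Derivable (.ok (Δ ++ K :: Γ)) →
      Derivable (.var (Δ ++ K :: Γ) Δ.length (K.rename (· + (Δ.length + 1))))
  /-- `K`-formation (the first premise follows from the others if there are any) -/
  | sortForm {Γ K} (hK : K ∈ L.ob) (x : L.out K → ℕ) : Derivable (.ok Γ) →
      (∀ f : L.out K, Derivable (.var Γ (x f) (L.depSort x f))) →
      Derivable (.sort Γ ⟨K, hK, x⟩)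
  | formWk {Γ Δ φ} : Derivable (.ok (Δ ++ Γ)) → Derivable (.formula Γ φ) →
      Derivable (.formula (Δ ++ Γ) (φ.rename (· + Δ.length)))
  | botForm {Γ} : Derivable (.ok Γ) → Derivable (.formula Γ .bot)
  | topForm {Γ} : Derivable (.ok Γ) → Derivable (.formula Γ .top)
  | andForm {Γ φ ψ} : Derivable (.ok Γ) → Derivable (.formula Γ φ) → Derivable (.formula Γ ψ) →
      Derivable (.formula Γ (.and φ ψ))
  | orForm {Γ φ ψ} : Derivable (.ok Γ) → Derivable (.formula Γ φ) → Derivable (.formula Γ ψ) →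
      Derivable (.formula Γ (.or φ ψ))
  | impForm {Γ φ ψ} : Derivable (.ok Γ) → Derivable (.formula Γ φ) → Derivable (.formula Γ ψ) →
      Derivable (.formula Γ (.imp φ ψ))
  | allForm {Γ K φ} : Derivable (.ok Γ) → Derivable (.formula (K :: Γ) φ) →
      Derivable (.formula Γ (.all K φ))
  | exForm {Γ K φ} : Derivable (.ok Γ) → Derivable (.formula (K :: Γ) φ) →
      Derivable (.formula Γ (.ex K φ))

end FOLDSSignature

/-! # Homotopy structures and the interpretation -/

namespace HSignature

open HoTT (Expr)

variable {O : Type u} {M : Type v} (L : HSignature O M)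

/-- `app [K (a_f)_{f ∈ K // L}]` for a term `k`: the successive application of `k` to the terms `a_f`,
or to `*` if `K // L` is empty. -/
noncomputable def appArgs (K : Ob O M) (k : Expr) (a : Mor O M → Expr) : Expr :=
  match L.outList K with
  | [] => .app k .star
  | fs => fs.foldl (fun e f => .app e (a f)) k

theorem src_mem {K : Ob O M} (hK : .iso K ∈ L.ob) : .src K ∈ L.hom (.iso K) K := by
  rw [L.iso_hom K hK]; exact .inl rfl

theorem rfl_mem {K : Ob O M} (hK : .rho K ∈ L.ob) : .rfl K ∈ L.hom (.rho K) (.iso K) := by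
  rw [L.rho_hom K hK]; rfl

theorem fst_mem {f : Mor O M} (hf : .tau f ∈ L.ob) : .fst f ∈ L.hom (.tau f) (L.dom f) := by
  have h : Mor.fst f ∈ L.top (.tau f) := by rw [L.tau_top f hf]; exact .inr (.inl rfl)
  exact ⟨h.1.1, h.1.2, L.tau_fst f hf⟩

open Classical in
/-- The type expression interpreting the sort `K (a_f)_{f ∈ K // L}`, for terms `a_f`, where the
non-logical sorts are interpreted by the terms `env`. Isomorphism sorts become identity types,
reflexivity sorts become types of identifications with `refl`, and transport sorts `τ_f` become types
of identifications with a transport along the family that varies in position `f` only. (The value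
for symbols that are not sorts of `L` is irrelevant.) -/
noncomputable def sortType (K : Ob O M) (env : Ob O M → Expr) (a : Mor O M → Expr) : Expr :=
  match K with
  | .base A => .elOfHLevel (L.h (.base A)) (L.appArgs (.base A) (env (.base A)) a)
  | .iso K =>
    if _hK : .iso K ∈ L.ob then
      .id (sortType K env fun p => a (L.comp p (.src K))) (a (.src K)) (a (.tgt K))
    else .empty
  | .rho K =>
    if _hK : .rho K ∈ L.ob then
      .id
        (.id (sortType K env fun p => a (L.comp p (L.comp (.src K) (.rfl K))))
          (a (L.comp (.src K) (.rfl K))) (a (L.comp (.tgt K) (.rfl K))))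
        (a (.rfl K)) (.refl (a (L.comp (.src K) (.rfl K))))
    else .empty
  | .tau f =>
    if _hf : .tau f ∈ L.ob then
      .id (sortType (L.dom f) env fun p => a (L.comp p (.snd f)))
        (a (.snd f))
        (.transport
          (sortType (L.dom f) (fun N => (env N).lift)
            fun p => if p = f then .var 0 else (a (L.comp p (.fst f))).lift)
          (a (L.comp f (.fst f))) (a (L.comp f (.snd f))) (a (.path f)) (a (.fst f)))
    else .empty
termination_by L.rank K
decreasing_by
  · have h := L.src_mem _hK
    have := L.rank_lt h.1
    rwa [h.2.1, h.2.2] at this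
  · have h := L.rfl_mem _hK
    have h1 := L.rank_lt h.1
    have h' := L.src_mem (h.2.2 ▸ L.cod_mem _ h.1)
    have h2 := L.rank_lt h'.1
    rw [h.2.1, h.2.2] at h1
    rw [h'.2.1, h'.2.2] at h2
    exact h2.trans h1
  all_goals
    have h := L.fst_mem _hf
    have := L.rank_lt h.1
    rwa [h.2.1, h.2.2] at this

open Classical in
/-- `Π (f : K_f)_{f ∈ fs} U^m`, where the arrow symbols serve as variables: `a` records the terms
denoted by the arrow symbols declared so far. -/
noncomputable def piOut (m : ℕ∞) (env : Ob O M → Expr) (a : Mor O M → Expr) :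
    List (Mor O M) → Expr
  | [] => .typesOfHLevel m
  | f :: fs =>
    .pi (L.sortType (L.cod f) env fun p => a (L.comp p f))
      (piOut m (fun N => (env N).lift) (fun g => if g = f then .var 0 else (a g).lift) fs)

/-- The type expression `T_K`; it is `1 → U^{h(K)}` if `K // L` is empty. No arrow symbol is declared
at the outset. -/
noncomputable def familyType (K : Ob O M) (env : Ob O M → Expr) : Expr :=
  match L.outList K with
  | [] => .arrow .unit (.typesOfHLevel (L.h K))
  | fs => L.piOut (L.h K) env (fun _ => .star) fs

open Classical in
/-- `(K₁ : T_{K₁}) × ⋯ × (Kₘ : T_{Kₘ})` for a list of non-logical sorts, which serve as variables;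
the empty sum is `0`. -/
noncomputable def sigmaSorts (env : Ob O M → Expr) : List (Ob O M) → Expr
  | [] => .empty
  | [K] => L.familyType K env
  | K :: Ks =>
    .sigma (L.familyType K env)
      (sigmaSorts (fun N => if N = K then .var 0 else (env N).lift) Ks)

/-- `HStruc (L)`, the type of homotopy `L`-structures. -/
noncomputable def hStruc : Expr := L.sigmaSorts (fun _ => .star) L.nonLogicalList

open Classical in
/-- The component with label `K` of a term `t` of an iterated sum with the given labels. -/
noncomputable def projAt (K : Ob O M) : List (Ob O M) → Expr → Expr
  | [], t => t
  | [_], t => t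
  | K' :: Ks, t => if K = K' then .fst t else projAt K Ks (.snd t)

/-- `K^𝓜`, for the structure `𝓜` declared before `n` other variables. -/
noncomputable def structEnv (n : ℕ) (K : Ob O M) : Expr := projAt K L.nonLogicalList (.var n)

open Classical in
/-- The interpretation of a sort expression over a context of length `n`. -/
noncomputable def interpSort (n : ℕ) (K : L.SortExpr) : Expr :=
  L.sortType K.head (L.structEnv n)
    fun f => if hf : f ∈ L.out K.head then .var (K.args ⟨f, hf⟩) else .star

/-- The interpretation of a context: the empty context becomes `𝓜 : HStruc (L)`. -/
noncomputable def interpCtx : List L.SortExpr → List Expr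
  | [] => [L.hStruc]
  | K :: Γ => L.interpSort Γ.length K :: interpCtx Γ

/-- The interpretation of a formula over a context of length `n`. -/
noncomputable def interpFormula : ℕ → L.Formula → Expr
  | _, .bot => .empty
  | _, .top => .unit
  | n, .and φ ψ => .prod (interpFormula n φ) (interpFormula n ψ)
  | n, .or φ ψ => .trunc (.sum (interpFormula n φ) (interpFormula n ψ))
  | n, .imp φ ψ => .arrow (interpFormula n φ) (interpFormula n ψ)
  | n, .all K φ => .pi (L.interpSort n K) (interpFormula (n + 1) φ)
  | n, .ex K φ => .trunc (.sigma (L.interpSort n K) (interpFormula (n + 1) φ))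

/-- The interpretation of the judgments of the logical type theory of `L` in HoTT. -/
noncomputable def interp : L.Judgment → HoTT.Judgment
  | .ok Γ => .ok (L.interpCtx Γ)
  | .sort Γ K => .ty (L.interpCtx Γ) (L.interpSort Γ.length K)
  | .var Γ x K => .tm (L.interpCtx Γ) (.var x) (L.interpSort Γ.length K)
  | .formula Γ φ => .ty (L.interpCtx Γ) (L.interpFormula Γ.length φ)

end HSignature

end FOLIso

/-!
The interpretation commutes with substitution, and the interpretation of a sort depends only on the
arguments along its outgoing arrows and on the non-logical sorts reachable from it. Hence
`K`-formation is sound by induction on `K`. Only transport sorts need an argument: as `f` is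
top-level, no other argument of its domain depends on the one along `f`, so the latter can be
replaced by a variable `x` to give a family `P[x]` of types, and the transport is path induction
into `P[x] → P[y]`.

The types `T_K` and `HStruc(L)` are typed by recursion along the increasing enumerations of
`K // L` and of the non-logical sorts: as the codomain of an arrow precedes its domain, everything
that occurs in an entry stands before it. In the same order the projections of the generic structure
`𝓜 : HStruc(L)` are seen to have the types `T_K`.
-/

namespace HoTT

namespace Expr

theorem ups_comp_var (ρ : ℕ → ℕ) : ups (fun i => var (ρ i)) = fun i => var (upr ρ i) := by
  funext i; cases i <;> rfl

theorem rename_eq_subst (e : Expr) (ρ : ℕ → ℕ) : e.rename ρ = e.subst fun i => var (ρ i) := by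
  induction e generalizing ρ <;> simp only [rename, subst, ups_comp_var, *]

theorem ups_var : ups var = var := by
  funext i; cases i <;> rfl

theorem subst_var (e : Expr) : e.subst var = e := by
  induction e <;> simp only [subst, ups_var, *]

theorem ups_comp_upr (σ : ℕ → Expr) (ρ : ℕ → ℕ) :
    (fun i => ups σ (upr ρ i)) = ups fun i => σ (ρ i) := by
  funext i; cases i <;> rfl

theorem rename_subst (e : Expr) (ρ : ℕ → ℕ) (σ : ℕ → Expr) :
    (e.rename ρ).subst σ = e.subst fun i => σ (ρ i) := by
  induction e generalizing ρ σ <;> simp only [rename, subst, ups_comp_upr, *]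

theorem rename_rename (e : Expr) (ρ ρ' : ℕ → ℕ) :
    (e.rename ρ).rename ρ' = e.rename fun i => ρ' (ρ i) := by
  rw [rename_eq_subst _ ρ', rename_subst, ← rename_eq_subst e fun i => ρ' (ρ i)]

theorem rename_add_zero (e : Expr) : e.rename (· + 0) = e := by
  rw [rename_eq_subst]; exact subst_var e

theorem lift_rename_add (e : Expr) (n : ℕ) : e.lift.rename (· + n) = e.rename (· + (n + 1)) := by
  rw [lift, rename_rename]; congr 1; funext i; exact Nat.succ_add_eq_add_succ i n

theorem rename_add_lift (e : Expr) (n : ℕ) : (e.rename (· + n)).lift = e.rename (· + (n + 1)) := by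
  rw [lift, rename_rename]; rfl

theorem ups_rename_upr (σ : ℕ → Expr) (ρ : ℕ → ℕ) :
    (fun i => (ups σ i).rename (upr ρ)) = ups fun i => (σ i).rename ρ := by
  funext i
  cases i with
  | zero => rfl
  | succ i => simp only [ups, lift, rename_rename, upr]

theorem subst_rename (e : Expr) (σ : ℕ → Expr) (ρ : ℕ → ℕ) :
    (e.subst σ).rename ρ = e.subst fun i => (σ i).rename ρ := by
  induction e generalizing σ ρ <;> simp only [rename, subst, ups_rename_upr, *]

theorem lift_subst_ups (e : Expr) (σ : ℕ → Expr) : e.lift.subst (ups σ) = (e.subst σ).lift := by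
  rw [lift, lift, rename_subst, subst_rename]; rfl

theorem ups_subst_ups (σ τ : ℕ → Expr) :
    (fun i => (ups σ i).subst (ups τ)) = ups fun i => (σ i).subst τ := by
  funext i
  cases i with
  | zero => rfl
  | succ i => exact lift_subst_ups _ _

theorem subst_subst (e : Expr) (σ τ : ℕ → Expr) :
    (e.subst σ).subst τ = e.subst fun i => (σ i).subst τ := by
  induction e generalizing σ τ <;> simp only [subst, ups_subst_ups, *]

/-- The substitution that sends the most recently declared variable to `a` and the other variables
according to `σ`. -/
def scons (a : Expr) (σ : ℕ → Expr) : ℕ → Expr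
  | 0 => a
  | i + 1 => σ i

theorem inst_eq_subst_scons (B a : Expr) : B.inst a = B.subst (scons a var) := rfl

theorem lift_subst_scons (e a : Expr) (σ : ℕ → Expr) : e.lift.subst (scons a σ) = e.subst σ := by
  rw [lift, rename_subst]; rfl

theorem lift_inst (e a : Expr) : e.lift.inst a = e := by
  rw [inst_eq_subst_scons, lift_subst_scons, subst_var]

theorem arrow_subst (A B : Expr) (σ : ℕ → Expr) :
    (arrow A B).subst σ = arrow (A.subst σ) (B.subst σ) := by
  simp only [arrow, subst, lift_subst_ups]

theorem arrow_rename (A B : Expr) (ρ : ℕ → ℕ) :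
    (arrow A B).rename ρ = arrow (A.rename ρ) (B.rename ρ) := by
  simp only [rename_eq_subst, arrow_subst]

theorem prod_rename (A B : Expr) (ρ : ℕ → ℕ) :
    (prod A B).rename ρ = prod (A.rename ρ) (B.rename ρ) := by
  simp only [rename_eq_subst, prod, subst, lift_subst_ups]

/-- The motive `x, y, q. P[x] → P[y]` of the path induction that defines the transport in `P`. -/
def transportMotive (P : Expr) : Expr :=
  arrow (P.subst (scons (var 2) fun i => var (i + 3)))
    (P.subst (scons (var 1) fun i => var (i + 3)))

theorem transport_eq_app_idrec (P a b p t : Expr) :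
    transport P a b p t = app (idrec (transportMotive P) (lam P (var 0)) a b p) t := by
  simp only [transport, transportMotive, rename_eq_subst]
  congr 4 <;> (funext i; cases i <;> rfl)

theorem transport_subst (P a b p t : Expr) (σ : ℕ → Expr) :
    (transport P a b p t).subst σ =
      transport (P.subst (ups σ)) (a.subst σ) (b.subst σ) (p.subst σ) (t.subst σ) := by
  simp only [transport, subst, arrow_subst, rename_subst, subst_rename]
  congr 4
  all_goals
    funext i
    cases i with
    | zero => rfl
    | succ i => simp only [ups, lift, rename_rename]

theorem transportMotive_inst3 (P a b p : Expr) :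
    (transportMotive P).inst3 a b p = arrow (P.inst a) (P.inst b) := by
  rw [transportMotive, inst3, arrow_subst, inst, inst, subst_subst, subst_subst]
  congr 2 <;> (funext i; cases i <;> rfl)

theorem transportMotive_diag (P : Expr) : (transportMotive P).diag = arrow P P := by
  have subst_id (σ : ℕ → Expr) (h₀ : σ 0 = var 0) (h : ∀ i, σ (i + 1) = var (i + 1)) :
      P.subst σ = P := by
    have : σ = var := by funext i; cases i <;> simp only [h₀, h]
    rw [this, subst_var]
  rw [transportMotive, diag, arrow_subst, subst_subst, subst_subst]
  congr 1 <;> exact subst_id _ rfl fun _ => rfl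

theorem isOfHLevel_subst (n : ℕ) (A : Expr) (σ : ℕ → Expr) :
    (isOfHLevel n A).subst σ = isOfHLevel n (A.subst σ) := by
  induction n generalizing A σ with
  | zero => simp only [isOfHLevel, subst, lift_subst_ups]; rfl
  | succ n ih => simp only [isOfHLevel, subst, ih, lift_subst_ups]; rfl

theorem typesOfHLevel_subst (m : ℕ∞) (σ : ℕ → Expr) :
    (typesOfHLevel m).subst σ = typesOfHLevel m := by
  unfold typesOfHLevel
  split_ifs
  · rfl
  · simp only [subst, isOfHLevel_subst]; rfl

theorem elOfHLevel_subst (m : ℕ∞) (a : Expr) (σ : ℕ → Expr) :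
    (elOfHLevel m a).subst σ = elOfHLevel m (a.subst σ) := by
  unfold elOfHLevel
  split_ifs <;> rfl

open Classical in
/-- The assignment of terms to names obtained from `a` by declaring one more variable, named `x`. -/
noncomputable def declare {α : Type*} (x : α) (a : α → Expr) : α → Expr :=
  Function.update (fun y => (a y).lift) x (var 0)

section

variable {α : Type*} (x : α) (a : α → Expr)

open Classical in
theorem declare_eq_ite : declare x a = fun y => if y = x then var 0 else (a y).lift :=
  funext fun _ => Function.update_apply ..

theorem declare_self : declare x a x = var 0 := by
  classical exact Function.update_self ..

variable {x} in
theorem declare_of_ne {y : α} (h : y ≠ x) : declare x a y = (a y).lift := by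
  classical exact Function.update_of_ne h ..

theorem eqOn_declare {a a' : α → Expr} {S : Set α} (h : Set.EqOn a a' S) :
    Set.EqOn (declare x a) (declare x a') S := by
  intro y hy
  simp only [declare_eq_ite, h hy]

open Classical in
theorem declare_subst_scons (t : Expr) (σ : ℕ → Expr) :
    (fun y => (declare x a y).subst (scons t σ)) =
      Function.update (fun y => (a y).subst σ) x t := by
  funext y
  simp only [declare, Function.apply_update (fun _ e => subst (scons t σ) e), lift_subst_scons]
  rfl

theorem declare_subst_ups (σ : ℕ → Expr) :
    (fun y => (declare x a y).subst (ups σ)) = declare x fun y => (a y).subst σ := by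
  funext y
  simp only [declare, Function.apply_update (fun _ e => subst (ups σ) e), lift_subst_ups]
  rfl

end

end Expr

open _root_.HoTT.Expr Judgment

/-- The context of a judgment. -/
def Judgment.context : Judgment → List Expr
  | ok Γ | ty Γ _ | tyEq Γ _ _ | tm Γ _ _ | tmEq Γ _ _ _ => Γ

namespace Derivable

theorem ok_context {J : Judgment} (h : Derivable J) : Derivable (ok J.context) := by
  induction h <;> first | exact .nil | exact .cons ‹_› ‹_› | assumption

theorem ty_head {Γ : List Expr} {A : Expr} (h : Derivable (ok (A :: Γ))) : Derivable (ty Γ A) := by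
  cases h; assumption

theorem ok_of_append {Γ Δ : List Expr} (h : Derivable (ok (Δ ++ Γ))) : Derivable (ok Γ) := by
  induction Δ with
  | nil => exact h
  | cons B Δ ih => exact ih h.ty_head.ok_context

theorem wkTy_append {Γ Δ : List Expr} {A : Expr} (hΔ : Derivable (ok (Δ ++ Γ)))
    (hA : Derivable (ty Γ A)) : Derivable (ty (Δ ++ Γ) (A.rename (· + Δ.length))) := by
  induction Δ with
  | nil => rwa [List.length_nil, rename_add_zero]
  | cons B Δ ih =>
    rw [List.length_cons, ← rename_add_lift]
    exact wkTy hΔ (ih hΔ.ty_head.ok_context)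

theorem wkTm_append {Γ Δ : List Expr} {a A : Expr} (hΔ : Derivable (ok (Δ ++ Γ)))
    (ha : Derivable (tm Γ a A)) :
    Derivable (tm (Δ ++ Γ) (a.rename (· + Δ.length)) (A.rename (· + Δ.length))) := by
  induction Δ with
  | nil => rwa [List.length_nil, rename_add_zero, rename_add_zero]
  | cons B Δ ih =>
    rw [List.length_cons, ← rename_add_lift, ← rename_add_lift]
    exact wkTm hΔ (ih hΔ.ty_head.ok_context)

theorem var_append {Γ Δ : List Expr} {A : Expr} (h : Derivable (ok (Δ ++ A :: Γ))) :
    Derivable (tm (Δ ++ A :: Γ) (.var Δ.length) (A.rename (· + (Δ.length + 1)))) := by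
  have key := wkTm_append h (Derivable.var h.ok_of_append)
  rwa [lift_rename_add, rename, Nat.zero_add] at key

section

variable {Γ : List Expr} {A B : Expr}

theorem ok_cons (hA : Derivable (ty Γ A)) : Derivable (ok (A :: Γ)) := cons hA.ok_context hA

theorem arrowForm (hA : Derivable (ty Γ A)) (hB : Derivable (ty Γ B)) :
    Derivable (ty Γ (arrow A B)) :=
  piForm hA (wkTy hA.ok_cons hB)

theorem prodForm (hA : Derivable (ty Γ A)) (hB : Derivable (ty Γ B)) :
    Derivable (ty Γ (prod A B)) :=
  sigmaForm hA (wkTy hA.ok_cons hB)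

theorem arrowElim {f a : Expr} (hf : Derivable (tm Γ f (arrow A B))) (ha : Derivable (tm Γ a A)) :
    Derivable (tm Γ (app f a) B) := by
  simpa only [lift_inst] using piElim hf ha

theorem wkTy_self (hA : Derivable (ty Γ A)) : Derivable (ty (A :: Γ) A.lift) := wkTy hA.ok_cons hA

theorem pathForm (hA : Derivable (ty Γ A)) :
    Derivable (ty (A.lift :: A :: Γ) (Expr.id A.lift.lift (.var 1) (.var 0))) :=
  have hok : Derivable (ok (A.lift :: A :: Γ)) := hA.wkTy_self.ok_cons
  idForm hA.wkTy_self.wkTy_self (wkTm hok (Derivable.var hA.ok_cons)) (Derivable.var hok)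

theorem isOfHLevelForm (n : ℕ) (hA : Derivable (ty Γ A)) : Derivable (ty Γ (isOfHLevel n A)) := by
  induction n generalizing Γ A with
  | zero => exact sigmaForm hA (piForm hA.wkTy_self hA.pathForm)
  | succ n ih => exact piForm hA (piForm hA.wkTy_self (ih hA.pathForm))

theorem typesOfHLevelForm (m : ℕ∞) (hΓ : Derivable (ok Γ)) :
    Derivable (ty Γ (typesOfHLevel m)) := by
  have hU : Derivable (ty Γ univ) := univForm hΓ
  unfold typesOfHLevel
  split_ifs
  · exact hU
  · exact sigmaForm hU (isOfHLevelForm _ (elForm (Derivable.var hU.ok_cons)))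

theorem elOfHLevelForm (m : ℕ∞) {a : Expr} (ha : Derivable (tm Γ a (typesOfHLevel m))) :
    Derivable (ty Γ (elOfHLevel m a)) := by
  unfold typesOfHLevel at ha
  unfold elOfHLevel
  split_ifs at ha ⊢
  · exact elForm ha
  · exact elForm (sigmaFst ha)

end

end Derivable

/-- `P`, which binds one variable, is a family of types over the type `A` in context `Γ`, stably
under extension of the context: `P[x]` is a type for each term `x : A` in a context `Γ, Δ`. With
this notion of family no substitution lemma for `Derivable` is needed. -/
def IsFamily (Γ : List Expr) (A P : Expr) : Prop :=
  ∀ ⦃Δ : List Expr⦄ ⦃x : Expr⦄, Derivable (tm (Δ ++ Γ) x (A.rename (· + Δ.length))) →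
    Derivable (ty (Δ ++ Γ) (P.subst (scons x fun i => var (i + Δ.length))))

namespace IsFamily

variable {Γ : List Expr} {A P : Expr}

theorem ty (hP : IsFamily Γ A P) (hA : Derivable (ty Γ A)) : Derivable (ty (A :: Γ) P) := by
  have key := hP (Δ := [A]) (Derivable.var hA.ok_cons)
  have scons_var : scons (var 0) (fun i => var (i + [A].length)) = var := by
    funext i; cases i <;> rfl
  rwa [scons_var, subst_var] at key

theorem transportMotive_ty (hP : IsFamily Γ A P) (hA : Derivable (Judgment.ty Γ A)) :
    Derivable (Judgment.ty (Expr.id A.lift.lift (.var 1) (.var 0) :: A.lift :: A :: Γ)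
      (transportMotive P)) := by
  let Δ := [Expr.id A.lift.lift (.var 1) (.var 0), A.lift, A]
  have hΔ : Derivable (ok (Δ ++ Γ)) := hA.pathForm.ok_cons
  have var_two : Derivable (tm (Δ ++ Γ) (.var 2) (A.rename (· + 3))) :=
    Derivable.var_append (Δ := [_, _]) hΔ
  have var_one : Derivable (tm (Δ ++ Γ) (.var 1) (A.rename (· + 3))) := by
    rw [← lift_rename_add]
    exact Derivable.var_append (Δ := [_]) hΔ
  exact .arrowForm (hP (Δ := Δ) var_two) (hP (Δ := Δ) var_one)

theorem transport_tm (hP : IsFamily Γ A P) (hA : Derivable (Judgment.ty Γ A)) {a b p t : Expr}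
    (ha : Derivable (tm Γ a A)) (hb : Derivable (tm Γ b A)) (hp : Derivable (tm Γ p (.id A a b)))
    (ht : Derivable (tm Γ t (P.inst a))) : Derivable (tm Γ (transport P a b p t) (P.inst b)) := by
  have base : Derivable (tm (A :: Γ) (lam P (.var 0)) (transportMotive P).diag) := by
    rw [transportMotive_diag]
    exact .piIntro (hP.ty hA) (.var (hP.ty hA).ok_cons)
  have path_induction := Derivable.idElim hA (hP.transportMotive_ty hA) base ha hb hp
  rw [transportMotive_inst3] at path_induction
  rw [transport_eq_app_idrec]
  exact path_induction.arrowElim ht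

end IsFamily

end HoTT

namespace FOLIso

universe u v

section SortedList

variable {α : Type*} {lt : α → α → Prop} {S : Set α}

theorem sortedList_spec (H : ∃ l : List α, l.Pairwise lt ∧ ∀ a, a ∈ l ↔ a ∈ S) :
    (sortedList lt S).Pairwise lt ∧ ∀ a, a ∈ sortedList lt S ↔ a ∈ S := by
  rw [sortedList, dif_pos H]
  exact H.choose_spec

theorem pairwise_sortedList : (sortedList lt S).Pairwise lt := by
  by_cases H : ∃ l : List α, l.Pairwise lt ∧ ∀ a, a ∈ l ↔ a ∈ S
  · exact (sortedList_spec H).1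
  · rw [sortedList, dif_neg H]
    exact .nil

theorem mem_of_mem_sortedList {a : α} (h : a ∈ sortedList lt S) : a ∈ S := by
  by_cases H : ∃ l : List α, l.Pairwise lt ∧ ∀ a, a ∈ l ↔ a ∈ S
  · exact ((sortedList_spec H).2 a).1 h
  · rw [sortedList, dif_neg H] at h
    cases h

variable [IsStrictTotalOrder S (Subrel lt (· ∈ S))]

theorem exists_pairwise_enumeration (hS : S.Finite) :
    ∃ l : List α, l.Pairwise lt ∧ ∀ a, a ∈ l ↔ a ∈ S := by
  classical
  have := hS.fintype
  let _ : LinearOrder S := linearOrderOfSTO (Subrel lt (· ∈ S))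
  refine ⟨(Finset.univ : Finset S).sort.map Subtype.val, ?_, fun a => ?_⟩
  · exact List.pairwise_map.2 (Finset.sortedLT_sort _).pairwise
  · simp only [List.mem_map, Finset.mem_sort, Finset.mem_univ, true_and, Subtype.exists,
      exists_prop, exists_eq_right]

theorem mem_sortedList (hS : S.Finite) {a : α} : a ∈ sortedList lt S ↔ a ∈ S :=
  (sortedList_spec (exists_pairwise_enumeration hS)).2 a

theorem asymm_of_mem {a b : α} (ha : a ∈ S) (hb : b ∈ S) (hab : lt a b) : ¬ lt b a :=
  asymm_of (Subrel lt (· ∈ S)) (a := ⟨a, ha⟩) (b := ⟨b, hb⟩) hab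

variable {l r : List α} {x y : α} (hl : sortedList lt S = l ++ x :: r)
include hl

theorem not_lt_of_mem_predecessors (hy : y ∈ insert x {z | z ∈ l}) : ¬ lt x y := by
  have hS {z : α} (hz : z ∈ l ++ x :: r) : z ∈ S := mem_of_mem_sortedList (hl ▸ hz)
  have hx : x ∈ S := hS (by simp)
  have hlt := hl ▸ pairwise_sortedList (lt := lt) (S := S)
  obtain rfl | hy := hy
  · exact fun h => asymm_of_mem hx hx h h
  · exact asymm_of_mem (hS (List.mem_append_left _ hy)) hx
      ((List.pairwise_append.1 hlt).2.2 y hy x (.head _))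

theorem ne_of_mem_successors (hy : y ∈ r) : y ≠ x := by
  have hlt := hl ▸ pairwise_sortedList (lt := lt) (S := S)
  rintro rfl
  exact not_lt_of_mem_predecessors hl (.inl rfl)
    ((List.pairwise_cons.1 (List.pairwise_append.1 hlt).2.1).1 y hy)

theorem mem_predecessors_of_lt (hS : S.Finite) (hy : y ∈ S) (hyx : lt y x) : y ∈ l := by
  have hx : x ∈ S := mem_of_mem_sortedList (lt := lt) (hl ▸ by simp)
  have hlt := hl ▸ pairwise_sortedList (lt := lt) (S := S)
  have hmem : y ∈ l ++ x :: r := hl ▸ (mem_sortedList hS).2 hy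
  rcases List.mem_append.1 hmem with h | h
  · exact h
  · rcases List.mem_cons.1 h with rfl | h
    · exact (asymm_of_mem hx hx hyx hyx).elim
    · exact (asymm_of_mem hy hx hyx
        ((List.pairwise_cons.1 (List.pairwise_append.1 hlt).2.1).1 y h)).elim

end SortedList

namespace FOLDSSignature

variable {O : Type u} {M : Type v} {L : FOLDSSignature O M}

instance (K : Ob O M) : IsStrictTotalOrder (L.out K) (Subrel L.morLt (· ∈ L.out K)) where
  irrefl f := L.morLt_irrefl f f.2.1
  trans f g k := L.morLt_trans f f.2.1 g g.2.1 k k.2.1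
  trichotomous f g hfg hgf := by
    by_contra hne
    exact (L.morLt_total f f.2.1 g g.2.1 (f.2.2.trans g.2.2.symm)
      (fun e => hne (Subtype.ext e))).elim hfg hgf

instance : IsStrictTotalOrder L.nonLogical (Subrel L.obLt (· ∈ L.nonLogical)) where
  irrefl K := L.obLt_irrefl K K.2.1
  trans K K' K'' := L.obLt_trans K K.2.1 K' K'.2.1 K'' K''.2.1
  trichotomous K K' h h' := by
    by_contra hne
    exact (L.obLt_total K K.2.1 K' K'.2.1 K.2.2 K'.2.2 (fun e => hne (Subtype.ext e))).elim h h'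

section Arrows

variable {K K' K'' : Ob O M} {f g p : Mor O M}

theorem mem_outList (hK : K ∈ L.ob) : f ∈ L.outList K ↔ f ∈ L.out K :=
  mem_sortedList (S := L.out K) (L.finite_fanout K hK)

theorem mem_nonLogicalList (hL : L.EssentiallyFinite) :
    K ∈ L.nonLogicalList ↔ K ∈ L.nonLogical :=
  mem_sortedList hL

theorem mem_hom_of_mem_out (hf : f ∈ L.out K) : f ∈ L.hom K (L.cod f) := ⟨hf.1, hf.2, rfl⟩

theorem mem_out_of_mem_hom (hf : f ∈ L.hom K K') : f ∈ L.out K := ⟨hf.1, hf.2.1⟩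

theorem cod_mem_of_mem_hom (hf : f ∈ L.hom K K') : K' ∈ L.ob := hf.2.2 ▸ L.cod_mem f hf.1

theorem rank_lt_of_mem_hom (hf : f ∈ L.hom K K') : L.rank K' < L.rank K := by
  obtain ⟨hf, rfl, rfl⟩ := hf
  exact L.rank_lt hf

theorem comp_mem_hom (hf : f ∈ L.hom K K') (hg : g ∈ L.hom K' K'') : L.comp g f ∈ L.hom K K'' := by
  obtain ⟨hf, rfl, rfl⟩ := hf
  obtain ⟨hg, hgd, rfl⟩ := hg
  exact ⟨L.comp_mem f hf g hg hgd.symm, L.dom_comp f hf g hg hgd.symm,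
    L.cod_comp f hf g hg hgd.symm⟩

theorem comp_mem_out (hf : f ∈ L.hom K K') (hp : p ∈ L.out K') : L.comp p f ∈ L.out K :=
  mem_out_of_mem_hom (comp_mem_hom hf (mem_hom_of_mem_out hp))

theorem comp_assoc (hf : f ∈ L.hom K K') (hg : g ∈ L.hom K' K'') (hp : p ∈ L.out K'') :
    L.comp p (L.comp g f) = L.comp (L.comp p g) f :=
  L.assoc f hf.1 g hg.1 p hp.1 (hf.2.2.trans hg.2.1.symm) (hg.2.2.trans hp.2.symm)

theorem obLt_of_mem_hom (hf : f ∈ L.hom K K') : L.obLt K' K := by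
  obtain ⟨hf, rfl, rfl⟩ := hf
  exact L.cod_obLt_dom f hf

theorem morLt_comp (hf : f ∈ L.out K) (hp : p ∈ L.out (L.cod f)) : L.morLt (L.comp p f) f := by
  have hpf := comp_mem_hom (mem_hom_of_mem_out hf) (mem_hom_of_mem_out hp)
  refine L.morLt_of_cod _ hpf.1 _ hf.1 ?_
  rw [hpf.2.2]
  exact obLt_of_mem_hom (mem_hom_of_mem_out hp)

theorem comp_ne_of_mem_top (hf : f ∈ L.top K) (hg : g ∈ L.out K) (hp : p ∈ L.out (L.cod g)) :
    L.comp p g ≠ f :=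
  fun e => hf.2 ⟨g, hg.1, p, hp.1, hp.2.symm, e.symm⟩

variable {l r : List (Mor O M)}

theorem comp_mem_predecessors (hK : K ∈ L.ob) (hl : L.outList K = l ++ f :: r)
    (hp : p ∈ L.out (L.cod f)) : L.comp p f ∈ l := by
  have hf : f ∈ L.out K := (mem_outList hK).1 (hl ▸ by simp)
  exact mem_predecessors_of_lt (S := L.out K) hl (L.finite_fanout K hK)
    (comp_mem_out (mem_hom_of_mem_out hf) hp) (morLt_comp hf hp)

theorem comp_ne_of_mem_predecessors (hl : L.outList K = l ++ f :: r) (hg : g ∈ insert f {k | k ∈ l})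
    (hp : p ∈ L.out (L.cod g)) : L.comp p g ≠ f := by
  have hgl : g ∈ L.outList K := hl ▸ hg.elim (fun e => e ▸ by simp) (List.mem_append_left _)
  exact fun e => not_lt_of_mem_predecessors hl hg (e ▸ morLt_comp (mem_of_mem_sortedList hgl) hp)

end Arrows

section Dependencies

variable (L) in
/-- The non-logical sorts other than `K` on which `K` depends, that is, those that occur in the type
`T_K` if `K` is non-logical. -/
def dependencies (K : Ob O M) : Set (Ob O M) := {N | N.NonLogical ∧ (L.hom K N).Nonempty}

variable (L) in
/-- The non-logical sorts that occur in the interpretation of `K`. -/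
def support (K : Ob O M) : Set (Ob O M) := {N | N.NonLogical ∧ N = K} ∪ L.dependencies K

variable {K K' N : Ob O M} {f : Mor O M}

theorem base_mem_support (A : O) : .base A ∈ L.support (.base A) := .inl ⟨trivial, rfl⟩

theorem support_subset_dependencies (hf : f ∈ L.hom K K') : L.support K' ⊆ L.dependencies K := by
  rintro N (⟨hN, rfl⟩ | ⟨hN, p, hp⟩)
  · exact ⟨hN, f, hf⟩
  · exact ⟨hN, L.comp p f, comp_mem_hom hf hp⟩

theorem support_subset_support (hf : f ∈ L.hom K K') : L.support K' ⊆ L.support K :=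
  (support_subset_dependencies hf).trans Set.subset_union_right

theorem dependencies_subset_nonLogical : L.dependencies K ⊆ L.nonLogical :=
  fun _ ⟨hN, _, hf⟩ => ⟨cod_mem_of_mem_hom hf, hN⟩

theorem support_subset_nonLogical (hK : K ∈ L.ob) : L.support K ⊆ L.nonLogical :=
  Set.union_subset (fun _ ⟨hN, e⟩ => ⟨e ▸ hK, hN⟩) dependencies_subset_nonLogical

theorem obLt_of_mem_dependencies (hN : N ∈ L.dependencies K) : L.obLt N K :=
  obLt_of_mem_hom hN.2.choose_spec

variable {l r : List (Ob O M)}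

theorem dependencies_subset_predecessors (hL : L.EssentiallyFinite)
    (hl : L.nonLogicalList = l ++ K :: r) : L.dependencies K ⊆ {N | N ∈ l} :=
  fun _ hN => mem_predecessors_of_lt hl hL (dependencies_subset_nonLogical hN)
    (obLt_of_mem_dependencies hN)

theorem notMem_dependencies_of_mem_predecessors (hl : L.nonLogicalList = l ++ K :: r)
    (hN : N ∈ insert K {K' | K' ∈ l}) : K ∉ L.dependencies N :=
  fun h => not_lt_of_mem_predecessors hl hN (obLt_of_mem_dependencies h)

end Dependencies

end FOLDSSignature

open FOLDSSignature HoTT HoTT.Expr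
open HoTT.Judgment (ok ty tm)

namespace HSignature

variable {O : Type u} {M : Type v} {L : HSignature O M}

section LogicalSorts

variable {K : Ob O M} {f : Mor O M}

variable (L) in
theorem tgt_mem (hK : .iso K ∈ L.ob) : .tgt K ∈ L.hom (.iso K) K := by
  rw [L.iso_hom K hK]; exact .inr rfl

variable (L) in
theorem snd_mem (hf : .tau f ∈ L.ob) : .snd f ∈ L.hom (.tau f) (L.dom f) := by
  have h : Mor.snd f ∈ L.top (.tau f) := by rw [L.tau_top f hf]; exact .inr (.inr rfl)
  exact ⟨h.1.1, h.1.2, L.tau_snd f hf⟩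

variable (L) in
theorem path_mem (hf : .tau f ∈ L.ob) : .path f ∈ L.hom (.tau f) (.iso (L.cod f)) := by
  have h : Mor.path f ∈ L.top (.tau f) := by rw [L.tau_top f hf]; exact .inl rfl
  exact ⟨h.1.1, h.1.2, L.tau_path f hf⟩

variable (L) in
theorem src_comp_rfl_mem (hK : .rho K ∈ L.ob) : L.comp (.src K) (.rfl K) ∈ L.hom (.rho K) K :=
  comp_mem_hom (L.rfl_mem hK) (L.src_mem (cod_mem_of_mem_hom (L.rfl_mem hK)))

theorem mem_hom_of_tau_mem (hf : .tau f ∈ L.ob) : f ∈ L.hom (L.dom f) (L.cod f) :=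
  ⟨(L.tau_mem f hf).1, rfl, rfl⟩

variable (L) in
theorem sort_induction {P : Ob O M → Prop} (base : ∀ A, P (.base A))
    (iso : ∀ K, (.iso K ∈ L.ob → P K) → P (.iso K))
    (rho : ∀ K, (.rho K ∈ L.ob → P K) → P (.rho K))
    (tau : ∀ f, (.tau f ∈ L.ob → P (L.dom f) ∧ P (L.cod f)) → P (.tau f)) (K : Ob O M) : P K := by
  induction K using (measure L.rank).wf.induction with
  | _ K ih =>
    have ih {K' : Ob O M} {f : Mor O M} (hf : f ∈ L.hom K K') : P K' :=
      ih K' (rank_lt_of_mem_hom hf)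
    cases K with
    | base A => exact base A
    | iso K => exact iso K fun hK => ih (L.src_mem hK)
    | rho K => exact rho K fun hK => ih (L.src_comp_rfl_mem hK)
    | tau f =>
      exact tau f fun hf =>
        ⟨ih (L.fst_mem hf), ih (comp_mem_hom (L.fst_mem hf) (mem_hom_of_tau_mem hf))⟩

end LogicalSorts

section Equations

variable {K : Ob O M} {f : Mor O M} (env : Ob O M → Expr) (a : Mor O M → Expr)

theorem sortType_iso (hK : .iso K ∈ L.ob) : L.sortType (.iso K) env a =
    .id (L.sortType K env fun p => a (L.comp p (.src K))) (a (.src K)) (a (.tgt K)) := by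
  rw [sortType, dif_pos hK]

theorem sortType_rho (hK : .rho K ∈ L.ob) : L.sortType (.rho K) env a =
    .id
      (.id (L.sortType K env fun p => a (L.comp p (L.comp (.src K) (.rfl K))))
        (a (L.comp (.src K) (.rfl K))) (a (L.comp (.src K) (.rfl K))))
      (a (.rfl K)) (.refl (a (L.comp (.src K) (.rfl K)))) := by
  rw [sortType, dif_pos hK, L.rho_comp K hK]

theorem sortType_tau (hf : .tau f ∈ L.ob) : L.sortType (.tau f) env a =
    .id (L.sortType (L.dom f) env fun p => a (L.comp p (.snd f))) (a (.snd f))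
      (.transport
        (L.sortType (L.dom f) (fun N => (env N).lift) (declare f fun p => a (L.comp p (.fst f))))
        (a (L.comp f (.fst f))) (a (L.comp f (.snd f))) (a (.path f)) (a (.fst f))) := by
  rw [sortType, dif_pos hf, declare_eq_ite]

theorem piOut_cons (m : ℕ∞) (fs : List (Mor O M)) : L.piOut m env a (f :: fs) =
    .pi (L.sortType (L.cod f) env fun p => a (L.comp p f))
      (L.piOut m (fun N => (env N).lift) (declare f a) fs) := by
  rw [piOut, declare_eq_ite]

theorem sigmaSorts_cons_cons (K K' : Ob O M) (Ks : List (Ob O M)) :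
    L.sigmaSorts env (K :: K' :: Ks) =
      .sigma (L.familyType K env) (L.sigmaSorts (declare K env) (K' :: Ks)) := by
  rw [sigmaSorts, declare_eq_ite]
  exact nofun

open Classical in
theorem projAt_cons_cons (N K K' : Ob O M) (Ks : List (Ob O M)) (t : Expr) :
    projAt N (K :: K' :: Ks) t = if N = K then .fst t else projAt N (K' :: Ks) (.snd t) := rfl

end Equations

section Substitution

variable (env : Ob O M → Expr) (a : Mor O M → Expr) (σ : ℕ → Expr)

theorem foldl_app_subst (fs : List (Mor O M)) (k : Expr) :
    (fs.foldl (fun e f => app e (a f)) k).subst σ =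
      fs.foldl (fun e f => app e ((a f).subst σ)) (k.subst σ) := by
  induction fs generalizing k with
  | nil => rfl
  | cons f _ ih => exact ih _

theorem appArgs_subst (K : Ob O M) (k : Expr) :
    (L.appArgs K k a).subst σ = L.appArgs K (k.subst σ) fun f => (a f).subst σ := by
  unfold appArgs
  split
  · rfl
  · exact foldl_app_subst ..

theorem sortType_subst (K : Ob O M) : (L.sortType K env a).subst σ =
    L.sortType K (fun N => (env N).subst σ) fun f => (a f).subst σ := by
  induction K using L.sort_induction generalizing env a σ with
  | base A => simp only [sortType, elOfHLevel_subst, appArgs_subst]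
  | iso K ih =>
    by_cases hK : .iso K ∈ L.ob
    · simp only [sortType_iso _ _ hK, subst, ih hK]
    · simp only [sortType, dif_neg hK, subst]
  | rho K ih =>
    by_cases hK : .rho K ∈ L.ob
    · simp only [sortType_rho _ _ hK, subst, ih hK]
    · simp only [sortType, dif_neg hK, subst]
  | tau f ih =>
    by_cases hf : .tau f ∈ L.ob
    · simp only [sortType_tau _ _ hf, subst, transport_subst, (ih hf).1, lift_subst_ups,
        declare_subst_ups]
    · simp only [sortType, dif_neg hf, subst]

theorem sortType_rename (K : Ob O M) (ρ : ℕ → ℕ) : (L.sortType K env a).rename ρ =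
    L.sortType K (fun N => (env N).rename ρ) fun f => (a f).rename ρ := by
  simp only [rename_eq_subst, sortType_subst]

theorem piOut_subst (m : ℕ∞) (fs : List (Mor O M)) : (L.piOut m env a fs).subst σ =
    L.piOut m (fun N => (env N).subst σ) (fun f => (a f).subst σ) fs := by
  induction fs generalizing env a σ with
  | nil => exact typesOfHLevel_subst m σ
  | cons f fs ih =>
    simp only [piOut_cons, subst, sortType_subst, ih, lift_subst_ups, declare_subst_ups]

open Classical in
theorem piOut_declare_inst (m : ℕ∞) (fs : List (Mor O M)) (f : Mor O M) (t : Expr) :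
    (L.piOut m (fun N => (env N).lift) (declare f a) fs).inst t =
      L.piOut m env (Function.update a f t) fs := by
  simp only [inst_eq_subst_scons, piOut_subst, declare_subst_scons, lift_subst_scons, subst_var]

theorem familyType_subst (K : Ob O M) :
    (L.familyType K env).subst σ = L.familyType K fun N => (env N).subst σ := by
  unfold familyType
  split
  · rw [arrow_subst, typesOfHLevel_subst]; rfl
  · exact piOut_subst ..

theorem familyType_rename (K : Ob O M) (ρ : ℕ → ℕ) :
    (L.familyType K env).rename ρ = L.familyType K fun N => (env N).rename ρ := by
  simp only [rename_eq_subst, familyType_subst]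

theorem sigmaSorts_subst (Ks : List (Ob O M)) :
    (L.sigmaSorts env Ks).subst σ = L.sigmaSorts (fun N => (env N).subst σ) Ks := by
  induction Ks generalizing env σ with
  | nil => rfl
  | cons K Ks ih =>
    cases Ks with
    | nil => exact familyType_subst ..
    | cons K' Ks =>
      simp only [sigmaSorts_cons_cons, subst, familyType_subst, ih, declare_subst_ups]

open Classical in
theorem sigmaSorts_declare_inst (Ks : List (Ob O M)) (K : Ob O M) (t : Expr) :
    (L.sigmaSorts (declare K env) Ks).inst t = L.sigmaSorts (Function.update env K t) Ks := by
  simp only [inst_eq_subst_scons, sigmaSorts_subst, declare_subst_scons, subst_var]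

theorem projAt_rename (N : Ob O M) (Ks : List (Ob O M)) (t : Expr) (ρ : ℕ → ℕ) :
    (projAt N Ks t).rename ρ = projAt N Ks (t.rename ρ) := by
  induction Ks generalizing t with
  | nil => rfl
  | cons K Ks ih =>
    cases Ks with
    | nil => rfl
    | cons K' Ks => simp only [projAt_cons_cons, apply_ite (rename ρ), ih, rename]

end Substitution

section Congruence

variable {K : Ob O M} {env env' : Ob O M → Expr} {a a' : Mor O M → Expr}

theorem eqOn_comp {K' : Ob O M} {f : Mor O M} (hf : f ∈ L.hom K K') (ha : Set.EqOn a a' (L.out K)) :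
    Set.EqOn (fun p => a (L.comp p f)) (fun p => a' (L.comp p f)) (L.out K') :=
  fun _ hp => ha (comp_mem_out hf hp)

theorem appArgs_congr (k : Expr) (ha : Set.EqOn a a' (L.out K)) :
    L.appArgs K k a = L.appArgs K k a' := by
  unfold appArgs
  split
  · rfl
  · exact List.foldl_ext _ _ _ fun e f hf => congrArg _ (ha (mem_of_mem_sortedList hf))

theorem sortType_congr (henv : Set.EqOn env env' (L.support K)) (ha : Set.EqOn a a' (L.out K)) :
    L.sortType K env a = L.sortType K env' a' := by
  induction K using L.sort_induction generalizing env env' a a' with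
  | base A =>
    rw [sortType, sortType, henv (base_mem_support A), appArgs_congr _ ha]
  | iso K ih =>
    by_cases hK : .iso K ∈ L.ob
    · have hs := L.src_mem hK
      rw [sortType_iso _ _ hK, sortType_iso _ _ hK,
        ih hK (henv.mono (support_subset_support hs)) (eqOn_comp hs ha), ha (mem_out_of_mem_hom hs),
        ha (mem_out_of_mem_hom (L.tgt_mem hK))]
    · simp only [sortType, dif_neg hK]
  | rho K ih =>
    by_cases hK : .rho K ∈ L.ob
    · have hs := L.src_comp_rfl_mem hK
      rw [sortType_rho _ _ hK, sortType_rho _ _ hK,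
        ih hK (henv.mono (support_subset_support hs)) (eqOn_comp hs ha), ha (mem_out_of_mem_hom hs),
        ha (mem_out_of_mem_hom (L.rfl_mem hK))]
    · simp only [sortType, dif_neg hK]
  | tau f ih =>
    by_cases hf : .tau f ∈ L.ob
    · have h₁ := L.fst_mem hf
      have h₂ := L.snd_mem hf
      have hfK := mem_out_of_mem_hom (mem_hom_of_tau_mem hf)
      have henv_lift : Set.EqOn (fun N => (env N).lift) (fun N => (env' N).lift)
          (L.support (L.dom f)) := (henv.mono (support_subset_support h₁)).comp_left
      rw [sortType_tau _ _ hf, sortType_tau _ _ hf,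
        (ih hf).1 (henv.mono (support_subset_support h₂)) (eqOn_comp h₂ ha),
        (ih hf).1 henv_lift (eqOn_declare f (eqOn_comp h₁ ha)),
        ha (comp_mem_out h₁ hfK), ha (comp_mem_out h₂ hfK), ha (mem_out_of_mem_hom h₁),
        ha (mem_out_of_mem_hom h₂), ha (mem_out_of_mem_hom (L.path_mem hf))]
    · simp only [sortType, dif_neg hf]

theorem sortType_congr_args (ha : Set.EqOn a a' (L.out K)) :
    L.sortType K env a = L.sortType K env a' :=
  sortType_congr (fun _ _ => rfl) ha

theorem piOut_congr {m : ℕ∞} {fs : List (Mor O M)} (hfs : ∀ f ∈ fs, f ∈ L.out K)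
    (henv : Set.EqOn env env' (L.dependencies K)) : L.piOut m env a fs = L.piOut m env' a fs := by
  induction fs generalizing env env' a with
  | nil => rfl
  | cons f fs ih =>
    rw [List.forall_mem_cons] at hfs
    have henv_lift : Set.EqOn (fun N => (env N).lift) (fun N => (env' N).lift)
        (L.dependencies K) := henv.comp_left
    have hsupport := support_subset_dependencies (mem_hom_of_mem_out hfs.1)
    rw [piOut_cons, piOut_cons, ih hfs.2 henv_lift,
      sortType_congr (henv.mono hsupport) fun _ _ => rfl]

theorem familyType_congr (henv : Set.EqOn env env' (L.dependencies K)) :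
    L.familyType K env = L.familyType K env' := by
  unfold familyType
  split
  · rfl
  · exact piOut_congr (fun f hf => mem_of_mem_sortedList hf) henv

end Congruence

variable (L) in
/-- The terms `env` interpret the non-logical sorts in `S` over the context `Γ`. -/
def IsStruct (Γ : List Expr) (env : Ob O M → Expr) (S : Set (Ob O M)) : Prop :=
  ∀ N ∈ S, Derivable (tm Γ (env N) (L.familyType N env))

variable (L) in
/-- The terms `a` interpret the arrows in `S` over the context `Γ`: the term `a f` has the type that
interprets the codomain of `f`. For `S = K // L` these are the arguments of the sort `K`. -/
def IsArgs (Γ : List Expr) (env : Ob O M → Expr) (S : Set (Mor O M)) (a : Mor O M → Expr) : Prop :=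
  ∀ f ∈ S, Derivable (tm Γ (a f) (L.sortType (L.cod f) env fun p => a (L.comp p f)))

variable {Γ : List Expr} {env : Ob O M → Expr} {a : Mor O M → Expr}

namespace IsStruct

variable {S S' : Set (Ob O M)}

theorem mono (h : L.IsStruct Γ env S) (hS : S' ⊆ S) : L.IsStruct Γ env S' :=
  fun N hN => h N (hS hN)

theorem weaken {Δ : List Expr} (h : L.IsStruct Γ env S) (hΔ : Derivable (ok (Δ ++ Γ))) :
    L.IsStruct (Δ ++ Γ) (fun N => (env N).rename (· + Δ.length)) S := fun N hN => by
  simpa only [familyType_rename] using Derivable.wkTm_append hΔ (h N hN)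

theorem lift {B : Expr} (h : L.IsStruct Γ env S) (hB : Derivable (ok (B :: Γ))) :
    L.IsStruct (B :: Γ) (fun N => (env N).lift) S :=
  h.weaken (Δ := [B]) hB

theorem declare {K : Ob O M} (h : L.IsStruct Γ env S)
    (hK : Derivable (ok (L.familyType K env :: Γ))) (hS : ∀ N ∈ insert K S, K ∉ L.dependencies N) :
    L.IsStruct (L.familyType K env :: Γ) (declare K env) (insert K S) := by
  intro N hN
  have independent : L.familyType N (Expr.declare K env) = (L.familyType N env).lift :=
    (familyType_congr fun N' hN' => declare_of_ne _ (by rintro rfl; exact hS _ hN hN')).trans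
      (familyType_rename ..).symm
  rw [independent]
  by_cases e : N = K
  · rw [e, declare_self]
    exact .var hK
  · rw [declare_of_ne _ e]
    exact .wkTm hK (h N (hN.resolve_left e))

end IsStruct

namespace IsArgs

variable {S S' : Set (Mor O M)} {K K' : Ob O M} {f : Mor O M}

theorem mono (h : L.IsArgs Γ env S a) (hS : S' ⊆ S) : L.IsArgs Γ env S' a := fun f hf => h f (hS hf)

theorem weaken {Δ : List Expr} (h : L.IsArgs Γ env S a) (hΔ : Derivable (ok (Δ ++ Γ))) :
    L.IsArgs (Δ ++ Γ) (fun N => (env N).rename (· + Δ.length))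
      S (fun f => (a f).rename (· + Δ.length)) := fun f hf => by
  simpa only [sortType_rename] using Derivable.wkTm_append hΔ (h f hf)

theorem declare (h : L.IsArgs Γ env S a)
    (hf : Derivable (ok (L.sortType (L.cod f) env (fun p => a (L.comp p f)) :: Γ)))
    (hS : ∀ g ∈ insert f S, ∀ p ∈ L.out (L.cod g), L.comp p g ≠ f) :
    L.IsArgs (L.sortType (L.cod f) env (fun p => a (L.comp p f)) :: Γ) (fun N => (env N).lift)
      (insert f S) (declare f a) := by
  intro g hg
  have independent : L.sortType (L.cod g) (fun N => (env N).lift)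
      (fun p => Expr.declare f a (L.comp p g)) =
        (L.sortType (L.cod g) env fun p => a (L.comp p g)).lift :=
    (sortType_congr_args fun p hp => declare_of_ne _ (hS g hg p hp)).trans
      (sortType_rename ..).symm
  rw [independent]
  by_cases e : g = f
  · subst e
    rw [declare_self]
    exact .var hf
  · rw [declare_of_ne _ e]
    exact .wkTm hf (h g (hg.resolve_left e))

theorem comp_of_mapsTo (h : L.IsArgs Γ env S a) (hf : f ∈ L.hom K K')
    (hS : Set.MapsTo (L.comp · f) (L.out K') S) :
    L.IsArgs Γ env (L.out K') fun p => a (L.comp p f) := by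
  intro p hp
  have key := h _ (hS hp)
  have hp := mem_hom_of_mem_out hp
  rw [(comp_mem_hom hf hp).2.2] at key
  rwa [sortType_congr_args fun q hq => congrArg a (comp_assoc hf hp hq).symm]

theorem comp (h : L.IsArgs Γ env (L.out K) a) (hf : f ∈ L.hom K K') :
    L.IsArgs Γ env (L.out K') fun p => a (L.comp p f) :=
  h.comp_of_mapsTo hf fun _ hp => comp_mem_out hf hp

theorem tm_of_hom (h : L.IsArgs Γ env (L.out K) a) (hf : f ∈ L.hom K K') :
    Derivable (tm Γ (a f) (L.sortType K' env fun p => a (L.comp p f))) := by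
  obtain ⟨hf, hd, rfl⟩ := hf
  exact h f ⟨hf, hd⟩

theorem tm_of_hom_iso (h : L.IsArgs Γ env (L.out K) a) (hf : f ∈ L.hom K (.iso K')) :
    Derivable (tm Γ (a f) (.id (L.sortType K' env fun p => a (L.comp p (L.comp (.src K') f)))
      (a (L.comp (.src K') f)) (a (L.comp (.tgt K') f)))) := by
  have hK' := cod_mem_of_mem_hom hf
  have key := h.tm_of_hom hf
  rw [sortType_iso _ _ hK'] at key
  rwa [sortType_congr_args fun p hp => congrArg a (comp_assoc hf (L.src_mem hK') hp)]

open Classical in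
theorem update (h : L.IsArgs Γ env (L.out K) a) (hf : f ∈ L.top K) {y : Expr}
    (hy : Derivable (tm Γ y (L.sortType (L.cod f) env fun p => a (L.comp p f)))) :
    L.IsArgs Γ env (L.out K) (Function.update a f y) := by
  intro p hp
  have independent : Set.EqOn (fun q => Function.update a f y (L.comp q p))
      (fun q => a (L.comp q p)) (L.out (L.cod p)) := fun q hq =>
    Function.update_of_ne (comp_ne_of_mem_top hf hp hq) ..
  rw [sortType_congr_args independent]
  obtain rfl | e := eq_or_ne p f
  · rwa [Function.update_self]
  · rw [Function.update_of_ne e]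
    exact h p hp

end IsArgs

section Application

variable {K : Ob O M} {k : Expr}

theorem foldl_app_tm {m : ℕ∞} {l fs : List (Mor O M)} {b : Mor O M → Expr} (hK : K ∈ L.ob)
    (hl : L.outList K = l ++ fs) (ha : L.IsArgs Γ env (L.out K) a)
    (hb : Set.EqOn b a {g | g ∈ l}) (hk : Derivable (tm Γ k (L.piOut m env b fs))) :
    Derivable (tm Γ (fs.foldl (fun e f => app e (a f)) k) (typesOfHLevel m)) := by
  classical
  induction fs generalizing l b k with
  | nil => exact hk
  | cons f fs ih =>
    have haf := ha f ((mem_outList hK).1 (hl ▸ by simp))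
    rw [← sortType_congr_args fun p hp => hb (comp_mem_predecessors hK hl hp)] at haf
    rw [piOut_cons] at hk
    have happ := Derivable.piElim hk haf
    rw [piOut_declare_inst] at happ
    refine ih (l := l ++ [f]) (by simpa using hl) (fun g hg => ?_) happ
    obtain rfl | e := eq_or_ne g f
    · exact Function.update_self ..
    · rw [Function.update_of_ne e]
      exact hb (by simpa [e] using hg)

theorem appArgs_tm (hΓ : Derivable (ok Γ)) (hK : K ∈ L.ob) (ha : L.IsArgs Γ env (L.out K) a)
    (hk : Derivable (tm Γ k (L.familyType K env))) :
    Derivable (tm Γ (L.appArgs K k a) (typesOfHLevel (L.h K))) := by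
  unfold familyType at hk
  unfold appArgs
  split at hk
  · exact hk.arrowElim (.unitIntro hΓ)
  · exact foldl_app_tm (l := []) hK rfl ha (fun _ hg => by cases hg) hk

end Application

section SortFormation

variable {K : Ob O M} {f : Mor O M}

variable (L) in
/-- The rule of `K`-formation holds for the interpretation: a sort is sent to a type whenever its
arguments are terms of the right types. -/
def SoundFormation (K : Ob O M) : Prop :=
  ∀ ⦃Γ : List Expr⦄ ⦃env : Ob O M → Expr⦄ ⦃a : Mor O M → Expr⦄, Derivable (ok Γ) →
    L.IsStruct Γ env (L.support K) → L.IsArgs Γ env (L.out K) a →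
      Derivable (ty Γ (L.sortType K env a))

theorem SoundFormation.ty_comp {K' : Ob O M} (hK' : L.SoundFormation K') (hΓ : Derivable (ok Γ))
    (henv : L.IsStruct Γ env (L.support K)) (ha : L.IsArgs Γ env (L.out K) a)
    (hf : f ∈ L.hom K K') : Derivable (ty Γ (L.sortType K' env fun p => a (L.comp p f))) :=
  hK' hΓ (henv.mono (support_subset_support hf)) (ha.comp hf)

theorem soundFormation_base {A : O} (hA : .base A ∈ L.ob) : L.SoundFormation (.base A) := by
  intro Γ env a hΓ henv ha
  rw [sortType]
  exact .elOfHLevelForm _ (appArgs_tm hΓ hA ha (henv _ (base_mem_support A)))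

theorem soundFormation_iso (hiso : .iso K ∈ L.ob) (hK : L.SoundFormation K) :
    L.SoundFormation (.iso K) := by
  intro Γ env a hΓ henv ha
  have tgt_tm := ha.tm_of_hom (L.tgt_mem hiso)
  rw [← sortType_congr_args fun p hp => congrArg a (L.iso_comp K hiso p hp)] at tgt_tm
  rw [sortType_iso _ _ hiso]
  exact .idForm (hK.ty_comp hΓ henv ha (L.src_mem hiso)) (ha.tm_of_hom (L.src_mem hiso)) tgt_tm

theorem soundFormation_rho (hrho : .rho K ∈ L.ob) (hK : L.SoundFormation K) :
    L.SoundFormation (.rho K) := by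
  intro Γ env a hΓ henv ha
  have hs := L.src_comp_rfl_mem hrho
  have src_tm := ha.tm_of_hom hs
  have rfl_tm := ha.tm_of_hom_iso (L.rfl_mem hrho)
  rw [← L.rho_comp K hrho] at rfl_tm
  rw [sortType_rho _ _ hrho]
  exact .idForm (.idForm (hK.ty_comp hΓ henv ha hs) src_tm src_tm) rfl_tm (.idIntro src_tm)

/-- Since `f` is top-level, no other argument depends on the one indexed by `f`, so that it can be
replaced by a variable. -/
theorem SoundFormation.isFamily (hK : L.SoundFormation K) (henv : L.IsStruct Γ env (L.support K))
    (ha : L.IsArgs Γ env (L.out K) a) (hf : f ∈ L.top K) :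
    IsFamily Γ (L.sortType (L.cod f) env fun p => a (L.comp p f))
      (L.sortType K (fun N => (env N).lift) (declare f a)) := by
  intro Δ x hx
  have hΔ : Derivable (ok (Δ ++ Γ)) := hx.ok_context
  rw [sortType_rename] at hx
  simp only [sortType_subst, declare_subst_scons, lift_subst_scons, ← rename_eq_subst]
  exact hK hΔ (henv.weaken hΔ) ((ha.weaken hΔ).update hf hx)

open Classical in
theorem sortType_declare_inst (x : Expr) :
    (L.sortType K (fun N => (env N).lift) (declare f a)).inst x =
      L.sortType K env (Function.update a f x) := by
  simp only [inst_eq_subst_scons, sortType_subst, declare_subst_scons, lift_subst_scons, subst_var]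

theorem SoundFormation.transport_tm (hK : L.SoundFormation K) (hcod : L.SoundFormation (L.cod f))
    (hΓ : Derivable (ok Γ)) (henv : L.IsStruct Γ env (L.support K)) (hf : f ∈ L.top K)
    {a' : Mor O M → Expr} (ha : L.IsArgs Γ env (L.out K) a) (ha' : L.IsArgs Γ env (L.out K) a')
    (hne : Set.EqOn a a' (L.out K \ {f})) {p t : Expr}
    (hp : Derivable (tm Γ p
      (.id (L.sortType (L.cod f) env fun q => a (L.comp q f)) (a f) (a' f))))
    (ht : Derivable (tm Γ t (L.sortType K env a))) :
    Derivable (tm Γ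
      (transport (L.sortType K (fun N => (env N).lift) (declare f a)) (a f) (a' f) p t)
      (L.sortType K env a')) := by
  classical
  have hfK : f ∈ L.hom K (L.cod f) := mem_hom_of_mem_out hf.1
  have cod_ty := hcod.ty_comp hΓ henv ha hfK
  have tgt_tm := ha'.tm_of_hom hfK
  rw [← sortType_congr_args fun q hq =>
    hne ⟨comp_mem_out hfK hq, comp_ne_of_mem_top hf hf.1 hq⟩] at tgt_tm
  have fiber_src : (L.sortType K (fun N => (env N).lift) (declare f a)).inst (a f) =
      L.sortType K env a := by
    rw [sortType_declare_inst, Function.update_eq_self]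
  have fiber_tgt : (L.sortType K (fun N => (env N).lift) (declare f a)).inst (a' f) =
      L.sortType K env a' := by
    rw [sortType_declare_inst]
    refine sortType_congr_args fun p hp => ?_
    obtain rfl | e := eq_or_ne p f
    · exact Function.update_self ..
    · rw [Function.update_of_ne e]
      exact hne ⟨hp, e⟩
  rw [← fiber_src] at ht
  rw [← fiber_tgt]
  exact (hK.isFamily henv ha hf).transport_tm cod_ty (ha.tm_of_hom hfK) tgt_tm hp ht

theorem soundFormation_tau (hf : .tau f ∈ L.ob) (hdom : L.SoundFormation (L.dom f))
    (hcod : L.SoundFormation (L.cod f)) : L.SoundFormation (.tau f) := by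
  intro Γ env a hΓ henv ha
  have h₁ := L.fst_mem hf
  have h₂ := L.snd_mem hf
  have path_tm := ha.tm_of_hom_iso (L.path_mem hf)
  rw [L.tau_src f hf, L.tau_tgt f hf,
    sortType_congr_args fun q hq => congrArg a (comp_assoc h₁ (mem_hom_of_tau_mem hf) hq)]
    at path_tm
  rw [sortType_tau _ _ hf]
  exact .idForm (hdom.ty_comp hΓ henv ha h₂) (ha.tm_of_hom h₂)
    (hdom.transport_tm hcod hΓ (henv.mono (support_subset_support h₁)) (L.tau_mem f hf).2
      (ha.comp h₁) (ha.comp h₂) (fun p hp => congrArg a (L.tau_other f hf p hp.1 hp.2))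
      path_tm (ha.tm_of_hom h₁))

theorem soundFormation (hK : K ∈ L.ob) : L.SoundFormation K := by
  induction K using L.sort_induction with
  | base A => exact soundFormation_base hK
  | iso K ih => exact soundFormation_iso hK (ih hK (L.iso_mem K hK))
  | rho K ih => exact soundFormation_rho hK (ih hK (L.rho_mem K hK))
  | tau f ih =>
    have hf := (L.tau_mem f hK).1
    exact soundFormation_tau hK ((ih hK).1 (L.dom_mem f hf)) ((ih hK).2 (L.cod_mem f hf))

end SortFormation

section Structures

theorem piOut_ty {K : Ob O M} (m : ℕ∞) {l fs : List (Mor O M)} (hK : K ∈ L.ob)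
    (hl : L.outList K = l ++ fs) (hΓ : Derivable (ok Γ))
    (henv : L.IsStruct Γ env (L.dependencies K)) (ha : L.IsArgs Γ env {g | g ∈ l} a) :
    Derivable (ty Γ (L.piOut m env a fs)) := by
  induction fs generalizing Γ env a l with
  | nil => exact .typesOfHLevelForm m hΓ
  | cons f fs ih =>
    have hf : f ∈ L.hom K (L.cod f) := mem_hom_of_mem_out ((mem_outList hK).1 (hl ▸ by simp))
    have cod_ty := soundFormation (cod_mem_of_mem_hom hf) hΓ
      (henv.mono (support_subset_dependencies hf))
      (ha.comp_of_mapsTo hf fun _ hp => comp_mem_predecessors hK hl hp)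
    rw [piOut_cons]
    refine .piForm cod_ty (ih (l := l ++ [f]) (by simpa using hl) cod_ty.ok_cons
      (henv.lift cod_ty.ok_cons) ?_)
    refine (ha.declare cod_ty.ok_cons fun g hg p hp => comp_ne_of_mem_predecessors hl hg hp).mono ?_
    exact fun g hg => by simpa [or_comm] using hg

theorem familyType_ty {K : Ob O M} (hK : K ∈ L.ob) (hΓ : Derivable (ok Γ))
    (henv : L.IsStruct Γ env (L.dependencies K)) : Derivable (ty Γ (L.familyType K env)) := by
  unfold familyType
  split
  · exact .arrowForm (.unitForm hΓ) (.typesOfHLevelForm _ hΓ)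
  · exact piOut_ty _ (l := []) hK rfl hΓ henv fun _ hg => by cases hg

variable {l Ks : List (Ob O M)}

theorem sigmaSorts_ty (hL : L.EssentiallyFinite) (hl : L.nonLogicalList = l ++ Ks)
    (hΓ : Derivable (ok Γ)) (henv : L.IsStruct Γ env {N | N ∈ l}) :
    Derivable (ty Γ (L.sigmaSorts env Ks)) := by
  induction Ks generalizing Γ env l with
  | nil => exact .emptyForm hΓ
  | cons K Ks ih =>
    have hK : K ∈ L.nonLogical := (mem_nonLogicalList hL).1 (hl ▸ by simp)
    have K_ty := familyType_ty hK.1 hΓ (henv.mono (dependencies_subset_predecessors hL hl))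
    cases Ks with
    | nil => exact K_ty
    | cons K' Ks =>
      rw [sigmaSorts_cons_cons]
      refine .sigmaForm K_ty (ih (l := l ++ [K]) (by simpa using hl) K_ty.ok_cons ?_)
      have extended := henv.declare K_ty.ok_cons fun N hN =>
        notMem_dependencies_of_mem_predecessors hl hN
      refine extended.mono ?_
      exact fun g hg => by simpa [or_comm] using hg

theorem hStruc_ok (hL : L.EssentiallyFinite) : Derivable (ok [L.hStruc]) :=
  (sigmaSorts_ty (l := []) hL rfl .nil fun _ hN => by cases hN).ok_cons

theorem isStruct_of_projAt {env' : Ob O M → Expr} {t : Expr} (hL : L.EssentiallyFinite)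
    (hl : L.nonLogicalList = l ++ Ks) (ht : Derivable (tm Γ t (L.sigmaSorts env Ks)))
    (henv : Set.EqOn env env' {N | N ∈ l}) (henv' : ∀ N ∈ Ks, env' N = projAt N Ks t) :
    L.IsStruct Γ env' {N | N ∈ Ks} := by
  classical
  induction Ks generalizing env l t with
  | nil => exact fun _ hN => by cases hN
  | cons K Ks ih =>
    have K_congr : L.familyType K env = L.familyType K env' :=
      familyType_congr (henv.mono (dependencies_subset_predecessors hL hl))
    have hK := henv' K (.head _)
    cases Ks with
    | nil =>
      intro N hN
      obtain rfl := List.mem_singleton.1 hN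
      rw [hK, ← K_congr]
      exact ht
    | cons K' Ks =>
      rw [sigmaSorts_cons_cons] at ht
      rw [projAt_cons_cons, if_pos rfl] at hK
      have tail_tm := Derivable.sigmaSnd ht
      rw [sigmaSorts_declare_inst] at tail_tm
      have tail_struct := ih (l := l ++ [K]) (by simpa using hl) tail_tm
        (fun N hN => ?_) fun N hN => ?_
      · intro N hN
        obtain rfl | hN := List.mem_cons.1 hN
        · rw [hK, ← K_congr]
          exact .sigmaFst ht
        · exact tail_struct N hN
      · obtain rfl | e := eq_or_ne N K
        · rw [Function.update_self, hK]
        · rw [Function.update_of_ne e]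
          exact henv (by simpa [e] using hN)
      · rw [henv' N (.tail _ hN), projAt_cons_cons, if_neg (ne_of_mem_successors hl hN)]

end Structures

section Renaming

variable {n m : ℕ} {ρ : ℕ → ℕ}

theorem structEnv_rename (hρ : ρ n = m) :
    (fun N => (L.structEnv n N).rename ρ) = L.structEnv m := by
  funext N
  rw [structEnv, projAt_rename, rename, hρ, structEnv]

theorem interpSort_rename (hρ : ρ n = m) (K : L.SortExpr) :
    L.interpSort m (K.rename ρ) = (L.interpSort n K).rename ρ := by
  rw [interpSort, interpSort, sortType_rename, structEnv_rename hρ]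
  refine sortType_congr_args fun f hf => ?_
  have hf' : f ∈ L.out K.head := hf
  rw [dif_pos hf, dif_pos hf']
  rfl

theorem interpFormula_rename (hρ : ρ n = m) (φ : L.Formula) :
    L.interpFormula m (φ.rename ρ) = (L.interpFormula n φ).rename ρ := by
  have upr_succ {n m : ℕ} {ρ : ℕ → ℕ} (hρ : ρ n = m) : upr ρ (n + 1) = m + 1 :=
    congrArg (· + 1) hρ
  induction φ generalizing n m ρ with
  | bot => rfl
  | top => rfl
  | and φ ψ ihφ ihψ => simp only [Formula.rename, interpFormula, prod_rename, ihφ hρ, ihψ hρ]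
  | or φ ψ ihφ ihψ => simp only [Formula.rename, interpFormula, rename, ihφ hρ, ihψ hρ]
  | imp φ ψ ihφ ihψ => simp only [Formula.rename, interpFormula, arrow_rename, ihφ hρ, ihψ hρ]
  | all K φ ih =>
    simp only [Formula.rename, interpFormula, rename, interpSort_rename hρ, ih (upr_succ hρ)]
  | ex K φ ih =>
    simp only [Formula.rename, interpFormula, rename, interpSort_rename hρ, ih (upr_succ hρ)]

end Renaming

section Soundness

variable {Γ Δ : List L.SortExpr} {K : L.SortExpr}

theorem exists_interpCtx_append (Γ Δ : List L.SortExpr) :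
    ∃ Δ', Δ'.length = Δ.length ∧ L.interpCtx (Δ ++ Γ) = Δ' ++ L.interpCtx Γ := by
  induction Δ with
  | nil => exact ⟨[], rfl, rfl⟩
  | cons K Δ ih =>
    obtain ⟨Δ', hlen, hΔ'⟩ := ih
    exact ⟨L.interpSort (Δ ++ Γ).length K :: Δ', congrArg (· + 1) hlen, congrArg (_ :: ·) hΔ'⟩

theorem wkTy_interpCtx {A : Expr} (hΔ : Derivable (ok (L.interpCtx (Δ ++ Γ))))
    (hA : Derivable (ty (L.interpCtx Γ) A)) :
    Derivable (ty (L.interpCtx (Δ ++ Γ)) (A.rename (· + Δ.length))) := by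
  obtain ⟨Δ', hlen, hΔ'⟩ := exists_interpCtx_append Γ Δ
  rw [hΔ'] at hΔ ⊢
  rw [← hlen]
  exact .wkTy_append hΔ hA

theorem interp_sort_weaken (hΔ : Derivable (L.interp (.ok (Δ ++ Γ))))
    (hK : Derivable (L.interp (.sort Γ K))) :
    Derivable (L.interp (.sort (Δ ++ Γ) (K.rename (· + Δ.length)))) := by
  rw [interp, interpSort_rename (n := Γ.length) (by rw [List.length_append, add_comm])]
  exact wkTy_interpCtx hΔ hK

theorem interp_formula_weaken {φ : L.Formula} (hΔ : Derivable (L.interp (.ok (Δ ++ Γ))))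
    (hφ : Derivable (L.interp (.formula Γ φ))) :
    Derivable (L.interp (.formula (Δ ++ Γ) (φ.rename (· + Δ.length)))) := by
  rw [interp, interpFormula_rename (n := Γ.length) (by rw [List.length_append, add_comm])]
  exact wkTy_interpCtx hΔ hφ

theorem interp_var (h : Derivable (L.interp (.ok (Δ ++ K :: Γ)))) :
    Derivable (L.interp (.var (Δ ++ K :: Γ) Δ.length (K.rename (· + (Δ.length + 1))))) := by
  obtain ⟨Δ', hlen, hΔ'⟩ := exists_interpCtx_append (K :: Γ) Δ
  rw [interp, hΔ'] at h
  rw [interp, interpSort_rename (n := Γ.length) (by grind), hΔ', ← hlen]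
  exact .var_append h

theorem isStruct_structEnv (hL : L.EssentiallyFinite) (hΓ : Derivable (ok (L.interpCtx Γ))) :
    L.IsStruct (L.interpCtx Γ) (L.structEnv Γ.length) L.nonLogical := by
  induction Γ with
  | nil =>
    have generic := Derivable.var hΓ
    rw [hStruc, lift, rename_eq_subst, sigmaSorts_subst] at generic
    exact (isStruct_of_projAt (l := []) hL rfl generic (fun _ hN => by cases hN)
      fun _ _ => rfl).mono fun N hN => (mem_nonLogicalList hL).2 hN
  | cons K Γ ih =>
    have lift_structEnv :
        (fun N => (L.structEnv Γ.length N).lift) = L.structEnv (K :: Γ).length :=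
      structEnv_rename rfl
    rw [← lift_structEnv]
    exact (ih hΓ.ty_head.ok_context).lift hΓ

theorem interp_sort {K : Ob O M} (hL : L.EssentiallyFinite) (hK : K ∈ L.ob) (x : L.out K → ℕ)
    (hΓ : Derivable (L.interp (.ok Γ)))
    (hx : ∀ f, Derivable (L.interp (.var Γ (x f) (L.depSort x f)))) :
    Derivable (L.interp (.sort Γ ⟨K, hK, x⟩)) := by
  refine soundFormation hK hΓ
    ((isStruct_structEnv hL hΓ).mono (support_subset_nonLogical hK)) fun f hf => ?_
  have key := hx ⟨f, hf⟩
  rw [interp, interpSort, sortType_congr_args fun p hp => ?_] at key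
  · rwa [dif_pos hf]
  · have hp' : p ∈ L.out (L.depSort x ⟨f, hf⟩).head := hp
    rw [dif_pos hp', dif_pos (comp_mem_out (mem_hom_of_mem_out hf) hp)]
    rfl

end Soundness

end HSignature

end FOLIso

theorem mainTheorem2 {O : Type*} {M : Type*} (L : FOLIso.HSignature O M)
    (hL : L.EssentiallyFinite) (S : L.Judgment) (hS : L.Derivable S) :
    HoTT.Derivable (L.interp S) := by
  induction hS with
  | conEmpty => exact FOLIso.HSignature.hStruc_ok hL
  | conExt _ _ _ ihK => exact .ok_cons ihK
  | conWk _ _ ihΔ ihK => exact FOLIso.HSignature.interp_sort_weaken ihΔ ihK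
  | ax _ ih => exact FOLIso.HSignature.interp_var ih
  | sortForm hK x _ _ ihΓ ihx => exact FOLIso.HSignature.interp_sort hL hK x ihΓ ihx
  | formWk _ _ ihΔ ihφ => exact FOLIso.HSignature.interp_formula_weaken ihΔ ihφ
  | botForm _ ih => exact .emptyForm ih
  | topForm _ ih => exact .unitForm ih
  | andForm _ _ _ _ ihφ ihψ => exact .prodForm ihφ ihψ
  | orForm _ _ _ _ ihφ ihψ => exact .truncForm (.sumForm ihφ ihψ)
  | impForm _ _ _ _ ihφ ihψ => exact .arrowForm ihφ ihψ
  | allForm _ _ _ ihφ => exact .piForm ihφ.ok_context.ty_head ihφ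
  | exForm _ _ _ ihφ => exact .truncForm (.sigmaForm ihφ.ok_context.ty_head ihφ)
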